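/- **Theorem 4.6.** A *tree* is a partially ordered set $(T,\triangleleft)$ ($\triangleleft$ reflexive) such that $\{\nu:\nu\triangleleft\eta\}$ is linearly ordered for every $\eta\in T$. A *branch* of $T$ is a maximal convex linearly ordered subset; an *initial segment* is a (possibly empty) downward closed linearly ordered subset. For an initial segment $A$ let $top(A)=\{x\in T:(\forall t\in A)\,t\triangleleft x\}$. For $x,y\in T\setminus A$ let $x\sim^0_A y$ iff $(\forall t\in A)(t\triangleleft x\Leftrightarrow t\triangleleft y)$, and let $x\sim^1_A y$ iff $x\sim^0_A y$ and there is $z\in T\setminus A$ with $z\triangleleft x$, $z\triangleleft y$ and $z\sim^0_A x$; write $top(A)/{\sim^1_A}$ for the set of $\sim^1_A$-classes of elements of $top(A)\setminus A$. A linear order is *scattered* if it does not embed $\mathbb Q$. The *Hausdorff degree* of a scattered linear order $C$ is $0$ if $C$ is finite, and otherwise the least ordinal $\alpha$ such that $C=\sum_{i\in I}C_i$ with $I$ well ordered or inversely well ordered and every $C_i$ of Hausdorff degree $<\alpha$. A tree $T$ is *wild* if at least one of the following holds: (i) $\sup\{|top(A)/{\sim^1_A}| : A\subseteq T \text{ an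 initial segment}\}\ge\aleph_0$; (ii) some branch $B\subseteq T$ admits an order embedding $\mathbb Q\to B$; (iii) all branches of $T$ are scattered, and $\sup\{\mathrm{Hdeg}(B): B\text{ a branch of }T\}\ge\omega$. A *candidate* is a formula $\varphi(x,X,\bar Z)$ of the monadic second-order language of $\triangleleft$ together with a finite sequence $\bar P$ of subsets of $T$. It *defines a choice function* on $T$ if $T\models\varphi(a,A,\bar P)$ implies $a\in A$, every non-empty $X\subseteq T$ has some $y$ with $T\models\varphi(y,X,\bar P)$, and $T\models\varphi(a,A,\bar P)\wedge\varphi(b,A,\bar P)$ implies $a=b$. It *chooses from* $A\subseteq T$ if there is exactly one $a\in T$ with $T\models\varphi(a,A,\bar P)$ and this $a$ belongs to $A$. Let $T$ be a wild tree. Then no candidate defines a choice function on $T$. Moreover, every candidate fails to choose from some non-empty subset of $T$ that is linearly ordered or an anti-chain (pairwise incomparable elements). More precisely, if (i) holds, then every candidate fails to choose from some non-empty anti-chain; and if (ii) or (iii) holds, then every candidate fails to choose from some non-empty linearly ordered subset. -/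

import Mathlib

universe u

namespace WildTree

/-! ### Trees -/

/-- A partial order in which the elements below any given element are linearly ordered. -/
def IsTree (T : Type u) [PartialOrder T] : Prop :=
  ∀ x : T, IsChain (· ≤ ·) (Set.Iic x)

section Tree

variable {T : Type u} [PartialOrder T]

/-- A convex, linearly ordered subset. -/
def IsSubBranch (B : Set T) : Prop :=
  B.OrdConnected ∧ IsChain (· ≤ ·) B

/-- A maximal sub-branch. -/
def IsBranch (B : Set T) : Prop :=
  Maximal IsSubBranch B

/-- A downward closed sub-branch (the empty set is allowed). -/
def IsInitialSegment (A : Set T) : Prop :=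
  IsSubBranch A ∧ IsLowerSet A

/-- The elements lying above every element of `A`. -/
def top (A : Set T) : Set T :=
  {x | ∀ t ∈ A, t ≤ x}

/-- The relation `∼⁰` on `T \ A`: `x` and `y` break `A` in the same place. -/
def Sim0 (A : Set T) (x y : T) : Prop :=
  x ∉ A ∧ y ∉ A ∧ ∀ t ∈ A, (t ≤ x ↔ t ≤ y)

/-- The relation `∼¹` on `T \ A`. -/
def Sim1 (A : Set T) (x y : T) : Prop :=
  Sim0 A x y ∧ ∃ z, z ≤ x ∧ z ≤ y ∧ Sim0 A z x

/-- The set of `∼¹`-classes of elements of `top A` (the relation lives on `T \ A`, so a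
possible largest element of `A` is left out). -/
def topClasses (A : Set T) : Set (Set T) :=
  (fun x => {y | y ∈ top A \ A ∧ Sim1 A x y}) '' (top A \ A)

/-! ### Scattered chains and the Hausdorff degree -/

/-- The suborder on `C` does not embed the rationals. -/
def IsScattered (C : Set T) : Prop :=
  IsEmpty (ℚ ↪o C)

/-- `C` is the concatenation, in the order of the index set, of the segments `D i`. -/
def IsConcatenation {I : Type u} [LinearOrder I] (C : Set T) (D : I → Set T) : Prop :=
  (⋃ i, D i) = C ∧ ∀ i j, i < j → ∀ x ∈ D i, ∀ y ∈ D j, x < y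

/-- The chain `C` has Hausdorff degree `α`: degree `0` means finite, and otherwise `α` is
minimal such that `C` is a sum, along a well order or an inverse well order, of chains of
degree less than `α`. -/
def HasHdeg (α : Ordinal.{u}) (C : Set T) : Prop :=
  (∀ β, β < α → ¬ HasHdeg β C) ∧
    ((α = 0 ∧ C.Finite) ∨
      ∃ (I : Type u) (_ : LinearOrder I) (D : I → Set T),
        (WellFoundedLT I ∨ WellFoundedGT I) ∧ IsConcatenation C D ∧
          ∀ i, ∃ β, ∃ _ : β < α, HasHdeg β (D i))
termination_by α

/-- The Hausdorff degree of a scattered chain. -/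
noncomputable def hdeg (C : Set T) : Ordinal.{u} :=
  sInf {α | HasHdeg α C}

end Tree

/-! ### Wild trees -/

/-- The numbers of `∼¹`-classes above initial segments have supremum at least `ℵ₀`. -/
def UnboundedSplitting (T : Type u) [PartialOrder T] : Prop :=
  Cardinal.aleph0 ≤ ⨆ A : {A : Set T // IsInitialSegment A}, Cardinal.mk (topClasses A.1)

/-- Some branch embeds the rationals. -/
def HasRationalBranch (T : Type u) [PartialOrder T] : Prop :=
  ∃ B : Set T, IsBranch B ∧ Nonempty (ℚ ↪o B)

/-- All branches are scattered, and their Hausdorff degrees have supremum at least `ω`. -/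
def HasUnboundedHdeg (T : Type u) [PartialOrder T] : Prop :=
  (∀ B : Set T, IsBranch B → IsScattered B) ∧
    Ordinal.omega0 ≤ ⨆ B : {B : Set T // IsBranch B}, hdeg B.1

def IsWild (T : Type u) [PartialOrder T] : Prop :=
  UnboundedSplitting T ∨ HasRationalBranch T ∨ HasUnboundedHdeg T

/-! ### Monadic second-order logic of order -/

/-- Formulas of the monadic language of order with free element variables indexed by `Fin n`
and free set variables indexed by `Fin m`. A quantifier binds the variable with index `0` of
its body. -/
inductive Formula : ℕ → ℕ → Type
  | le {n m : ℕ} (i j : Fin n) : Formula n m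
  | eq {n m : ℕ} (i j : Fin n) : Formula n m
  | mem {n m : ℕ} (i : Fin n) (k : Fin m) : Formula n m
  | neg {n m : ℕ} (φ : Formula n m) : Formula n m
  | and {n m : ℕ} (φ ψ : Formula n m) : Formula n m
  | exElem {n m : ℕ} (φ : Formula (n + 1) m) : Formula n m
  | exSet {n m : ℕ} (φ : Formula n (m + 1)) : Formula n m

/-- Satisfaction; set quantifiers range over all subsets of `T`. -/
def Formula.Realize {T : Type u} [PartialOrder T] :
    {n m : ℕ} → Formula n m → (Fin n → T) → (Fin m → Set T) → Prop
  | _, _, .le i j, v, _ => v i ≤ v j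
  | _, _, .eq i j, v, _ => v i = v j
  | _, _, .mem i k, v, V => v i ∈ V k
  | _, _, .neg φ, v, V => ¬ φ.Realize v V
  | _, _, .and φ ψ, v, V => φ.Realize v V ∧ ψ.Realize v V
  | _, _, .exElem φ, v, V => ∃ a : T, φ.Realize (Fin.cons a v) V
  | _, _, .exSet φ, v, V => ∃ A : Set T, φ.Realize v (Fin.cons A V)

section Choice

variable {T : Type u} [PartialOrder T]

/-- `φ(a, A, P)` holds in `T`. -/
def Holds {l : ℕ} (φ : Formula 1 (l + 1)) (P : Fin l → Set T) (a : T) (A : Set T) : Prop :=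
  φ.Realize (fun _ => a) (Fin.cons A P)

/-- `φ(x, X, P)` defines a choice function from non-empty subsets of `T`. -/
def DefinesChoiceFunction {l : ℕ} (φ : Formula 1 (l + 1)) (P : Fin l → Set T) : Prop :=
  (∀ a A, Holds φ P a A → A.Nonempty ∧ a ∈ A) ∧
    (∀ X : Set T, X.Nonempty → ∃ y, Holds φ P y X) ∧
      ∀ a b A, Holds φ P a A → Holds φ P b A → a = b

/-- `φ(x, X, P)` chooses an element from `A`: it holds for exactly one `x`, and this `x`
belongs to `A`. -/
def ChoosesFrom {l : ℕ} (φ : Formula 1 (l + 1)) (P : Fin l → Set T) (A : Set T) : Prop :=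
  ∃ a ∈ A, ∀ b, Holds φ P b A ↔ b = a

end Choice

/-- Some monadic formula with finitely many set parameters defines a choice function. -/
def HasDefinableChoiceFunction (T : Type u) [PartialOrder T] : Prop :=
  ∃ (l : ℕ) (φ : Formula 1 (l + 1)) (P : Fin l → Set T), DefinesChoiceFunction φ P

end WildTree

namespace WildTree

/-! ### Monadic types -/

/-! A formula of depth `k` sees only the monadic `k`-type of the structure, and there are finitely
many `k`-types. Hence nothing can be chosen from a non-empty set in which every element `a` has
another element `b` such that marking `a` and marking `b` give the same type (`holds_of_mtype_eq`).
Types of the whole tree are assembled from types of parts by the composition theorem `mtype_iUnion`.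
When a tree is cut along a downward closed chain `J`, elements of different parts are compared
through the parts and membership in `J` alone, so `J` is carried along as an extra distinguished
set.

If an initial segment has more classes above it than there are types, two of these cones, each with
a marked element, have the same type. Exchanging the cones exchanges the marked elements
(`mtype_swap`), and these two elements form the required antichain.

For chains, pairs in a branch are coloured by the type of the segment between them; this colouring
is coherent. Along a copy of the integers whose consecutive pairs share one colour, the mark can be
shifted by one place (`mtype_shift`), so nothing can be chosen from that copy. Such a copy exists as
soon as the branch contains an alternating pattern (an increasing sequence, with decreasing
sequences in its gaps, increasing ones in their gaps, and so on) that is higher than the number of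
colours: unless a copy appears, each level contributes a new colour (`HasPattern.exists_isApex`).
Conversely, the absence of patterns of height `n` bounds the Hausdorff degree by a finite number
depending only on `n` (`exists_hasDegreeLE_univ`), and a copy of the rationals contains patterns of
every height. So (ii) and (iii) both provide branches with arbitrarily high patterns. -/

/-- The finite set of possible monadic `k`-types of structures with `m` distinguished subsets. -/
def MType : ℕ → ℕ → Type
  | 0, m => (Fin m → Fin m → Prop) × (Fin m → Fin m → Prop) × (Fin m → Prop)
  | k + 1, m => Set (MType k (m + 1))

instance MType.finite : ∀ k m, Finite (MType k m)
  | 0, m => by unfold MType; infer_instance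
  | k + 1, m => by
      have := MType.finite k (m + 1)
      unfold MType
      infer_instance

theorem cons_comp_lift {T : Type*} {m m' : ℕ} (f : Fin m' → Fin m) (A : Set T) (V : Fin m → Set T) :
    (Fin.cons A (V ∘ f) : Fin (m' + 1) → Set T) =
      (Fin.cons A V : Fin (m + 1) → Set T) ∘
        (Fin.cons 0 (Fin.succ ∘ f) : Fin (m' + 1) → Fin (m + 1)) := by
  funext i
  refine Fin.cases ?_ (fun i => ?_) i <;> simp

section Types

variable {T : Type u} [PartialOrder T]

/-- The monadic `k`-type of the suborder on `D` with distinguished subsets `V i ∩ D`. Elements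
are represented by singletons. -/
def mtype : (k : ℕ) → {m : ℕ} → Set T → (Fin m → Set T) → MType k m
  | 0, _, D, V =>
      (fun i j => ∃ x ∈ D, x ∈ V i ∧ x ∈ V j,
        fun i j => ∃ x ∈ D, ∃ y ∈ D, x ∈ V i ∧ y ∈ V j ∧ x ≤ y,
        fun i => ∀ x ∈ D, ∀ y ∈ D, x ∈ V i → y ∈ V i → x = y)
  | k + 1, m, D, V => {c : MType k (m + 1) | ∃ A : Set T, mtype k D (Fin.cons A V) = c}

theorem mtype_zero_eq_iff {m : ℕ} {D D' : Set T} {V V' : Fin m → Set T} :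
    mtype 0 D V = mtype 0 D' V' ↔
      (∀ i j, (∃ x ∈ D, x ∈ V i ∧ x ∈ V j) ↔ ∃ x ∈ D', x ∈ V' i ∧ x ∈ V' j) ∧
      (∀ i j, (∃ x ∈ D, ∃ y ∈ D, x ∈ V i ∧ y ∈ V j ∧ x ≤ y) ↔
        ∃ x ∈ D', ∃ y ∈ D', x ∈ V' i ∧ y ∈ V' j ∧ x ≤ y) ∧
      (∀ i, (∀ x ∈ D, ∀ y ∈ D, x ∈ V i → y ∈ V i → x = y) ↔
        ∀ x ∈ D', ∀ y ∈ D', x ∈ V' i → y ∈ V' i → x = y) := by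
  unfold mtype
  constructor
  · intro h
    have h1 := congrArg Prod.fst h
    have h2 := congrArg (fun z => z.2.1) h
    have h3 := congrArg (fun z => z.2.2) h
    refine ⟨fun i j => ?_, fun i j => ?_, fun i => ?_⟩
    · exact iff_of_eq (congrFun (congrFun h1 i) j)
    · exact iff_of_eq (congrFun (congrFun h2 i) j)
    · exact iff_of_eq (congrFun h3 i)
  · rintro ⟨h1, h2, h3⟩
    refine Prod.ext ?_ (Prod.ext ?_ ?_)
    · funext i j; exact propext (h1 i j)
    · funext i j; exact propext (h2 i j)
    · funext i; exact propext (h3 i)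

/-- One round of the back-and-forth game: a move `A` on one side has an answer `A'` on the other. -/
theorem exists_mtype_cons {k m : ℕ} {D D' : Set T} {V V' : Fin m → Set T}
    (h : mtype (k + 1) D V = mtype (k + 1) D' V') (A : Set T) :
    ∃ A' : Set T, mtype k D' (Fin.cons A' V') = mtype k D (Fin.cons A V) := by
  have : mtype k D (Fin.cons A V) ∈
      {c : MType k (m + 1) | ∃ A : Set T, mtype k D (Fin.cons A V) = c} := ⟨A, rfl⟩
  have h' : {c : MType k (m + 1) | ∃ A : Set T, mtype k D (Fin.cons A V) = c} =
      {c : MType k (m + 1) | ∃ A : Set T, mtype k D' (Fin.cons A V') = c} := h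
  rw [h'] at this
  exact this

theorem mtype_succ_eq {k m : ℕ} {D D' : Set T} {V V' : Fin m → Set T}
    (h : ∀ A : Set T, ∃ A' : Set T, mtype k D' (Fin.cons A' V') = mtype k D (Fin.cons A V))
    (h' : ∀ A' : Set T, ∃ A : Set T, mtype k D (Fin.cons A V) = mtype k D' (Fin.cons A' V')) :
    mtype (k + 1) D V = mtype (k + 1) D' V' := by
  change {c : MType k (m + 1) | ∃ A : Set T, mtype k D (Fin.cons A V) = c} =
      {c : MType k (m + 1) | ∃ A : Set T, mtype k D' (Fin.cons A V') = c}
  ext c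
  constructor
  · rintro ⟨A, rfl⟩; exact h A
  · rintro ⟨A, rfl⟩; exact h' A

/-- The type of `D` only depends on the traces of the distinguished sets on `D`. -/
theorem mtype_congr {k m : ℕ} {D : Set T} {V V' : Fin m → Set T}
    (h : ∀ i, ∀ x ∈ D, x ∈ V i ↔ x ∈ V' i) : mtype k D V = mtype k D V' := by
  induction k generalizing m with
  | zero =>
    rw [mtype_zero_eq_iff]
    refine ⟨fun i j => ?_, fun i j => ?_, fun i => ?_⟩
    · exact exists_congr fun x => and_congr_right fun hx => by rw [h i x hx, h j x hx]
    · refine exists_congr fun x => and_congr_right fun hx => exists_congr fun y =>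
        and_congr_right fun hy => by rw [h i x hx, h j y hy]
    · refine forall₂_congr fun x hx => forall₂_congr fun y hy => by rw [h i x hx, h i y hy]
  | succ k ih =>
    have key : ∀ A : Set T, mtype k D (Fin.cons A V) = mtype k D (Fin.cons A V') := fun A =>
      ih (Fin.cases (fun x _ => Iff.rfl) (fun i x hx => by simpa using h i x hx))
    exact mtype_succ_eq (fun A => ⟨A, (key A).symm⟩) (fun A => ⟨A, key A⟩)

/-- Equality of types survives reindexing the distinguished sets. -/
theorem mtype_comp {k m m' : ℕ} (f : Fin m' → Fin m) {D D' : Set T} {V V' : Fin m → Set T}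
    (h : mtype k D V = mtype k D' V') : mtype k D (V ∘ f) = mtype k D' (V' ∘ f) := by
  induction k generalizing m m' D D' with
  | zero =>
    rw [mtype_zero_eq_iff] at h ⊢
    exact ⟨fun i j => h.1 (f i) (f j), fun i j => h.2.1 (f i) (f j), fun i => h.2.2 (f i)⟩
  | succ k ih =>
    refine mtype_succ_eq (fun A => ?_) (fun A => ?_)
    · obtain ⟨A', hA'⟩ := exists_mtype_cons h A
      refine ⟨A', ?_⟩
      rw [cons_comp_lift, cons_comp_lift]
      exact ih _ hA'
    · obtain ⟨A', hA'⟩ := exists_mtype_cons h.symm A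
      refine ⟨A', ?_⟩
      rw [cons_comp_lift, cons_comp_lift]
      exact ih _ hA'

/-- Play the move `∅`, then forget the two sets added by it. -/
theorem mtype_of_succ {k m : ℕ} {D D' : Set T} {V V' : Fin m → Set T}
    (h : mtype (k + 1) D V = mtype (k + 1) D' V') : mtype k D V = mtype k D' V' := by
  obtain ⟨A', hA'⟩ := exists_mtype_cons h ∅
  have := mtype_comp Fin.succ hA'
  exact this.symm

theorem mtype_zero_of_mtype {k m : ℕ} {D D' : Set T} {V V' : Fin m → Set T}
    (h : mtype k D V = mtype k D' V') : mtype 0 D V = mtype 0 D' V' := by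
  induction k with
  | zero => exact h
  | succ k ih => exact ih (mtype_of_succ h)

/-! ### The composition theorem -/

/-- The parts `D p` are disjoint, and the order between elements `x`, `y` of different parts
only depends on the parts and on the membership of `x` in `J`. -/
def IsPiecewise {I : Type*} (D : I → Set T) (R : I → I → Prop) (J : Set T) : Prop :=
  (∀ p q x, x ∈ D p → x ∈ D q → p = q) ∧
    ∀ p q, p ≠ q → ∀ x ∈ D p, ∀ y ∈ D q, (x ≤ y ↔ R p q ∧ x ∈ J)

section Composition

variable {I : Type*} {R : I → I → Prop} {D D' : I → Set T} {m : ℕ} {s : Fin m}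
  {V V' : Fin m → Set T}

/-- The right-hand side uses only `R` and atomic data of single parts. The repetition `y ∈ V j ∧ y ∈
V j` gives non-emptiness the shape of the first component of a `0`-type. -/
theorem exists_le_iff_of_isPiecewise (hD : IsPiecewise D R (V s)) (i j : Fin m) :
    (∃ x ∈ ⋃ p, D p, ∃ y ∈ ⋃ p, D p, x ∈ V i ∧ y ∈ V j ∧ x ≤ y) ↔
      (∃ p, ∃ x ∈ D p, ∃ y ∈ D p, x ∈ V i ∧ y ∈ V j ∧ x ≤ y) ∨
      ∃ p q, p ≠ q ∧ R p q ∧ (∃ x ∈ D p, x ∈ V i ∧ x ∈ V s) ∧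
        ∃ y ∈ D q, y ∈ V j ∧ y ∈ V j := by
  constructor
  · rintro ⟨x, hx, y, hy, hxi, hyj, hxy⟩
    obtain ⟨p, hp⟩ := Set.mem_iUnion.1 hx
    obtain ⟨q, hq⟩ := Set.mem_iUnion.1 hy
    by_cases hpq : p = q
    · subst hpq
      exact Or.inl ⟨p, x, hp, y, hq, hxi, hyj, hxy⟩
    · have := (hD.2 p q hpq x hp y hq).1 hxy
      exact Or.inr ⟨p, q, hpq, this.1, ⟨x, hp, hxi, this.2⟩, y, hq, hyj, hyj⟩
  · rintro (⟨p, x, hp, y, hq, hxi, hyj, hxy⟩ | ⟨p, q, hpq, hR, ⟨x, hp, hxi, hxs⟩, y, hq, hyj, -⟩)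
    · exact ⟨x, Set.mem_iUnion.2 ⟨p, hp⟩, y, Set.mem_iUnion.2 ⟨p, hq⟩, hxi, hyj, hxy⟩
    · exact ⟨x, Set.mem_iUnion.2 ⟨p, hp⟩, y, Set.mem_iUnion.2 ⟨q, hq⟩, hxi, hyj,
        (hD.2 p q hpq x hp y hq).2 ⟨hR, hxs⟩⟩

theorem subsingleton_iff_of_isPiecewise (hD : IsPiecewise D R (V s)) (i : Fin m) :
    (∀ x ∈ ⋃ p, D p, ∀ y ∈ ⋃ p, D p, x ∈ V i → y ∈ V i → x = y) ↔
      (∀ p, ∀ x ∈ D p, ∀ y ∈ D p, x ∈ V i → y ∈ V i → x = y) ∧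
      ∀ p q, (∃ x ∈ D p, x ∈ V i ∧ x ∈ V i) → (∃ x ∈ D q, x ∈ V i ∧ x ∈ V i) → p = q := by
  constructor
  · intro h
    refine ⟨fun p x hx y hy => h x (Set.mem_iUnion.2 ⟨p, hx⟩) y (Set.mem_iUnion.2 ⟨p, hy⟩), ?_⟩
    rintro p q ⟨x, hx, hxi, -⟩ ⟨y, hy, hyi, -⟩
    have := h x (Set.mem_iUnion.2 ⟨p, hx⟩) y (Set.mem_iUnion.2 ⟨q, hy⟩) hxi hyi
    subst this
    exact hD.1 p q x hx hy
  · rintro ⟨h1, h2⟩ x hx y hy hxi hyi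
    obtain ⟨p, hp⟩ := Set.mem_iUnion.1 hx
    obtain ⟨q, hq⟩ := Set.mem_iUnion.1 hy
    obtain rfl := h2 p q ⟨x, hp, hxi, hxi⟩ ⟨y, hq, hyi, hyi⟩
    exact h1 p x hp y hq hxi hyi

/-- Answer the move `A` in each part separately and glue the answers; disjointness of the parts
makes the glued set have the right trace on each of them. -/
theorem exists_mtype_cons_iUnion {k : ℕ} (hD' : IsPiecewise D' R (V' s))
    (ih : ∀ A A' : Set T,
      (∀ p, mtype k (D p) (Fin.cons A V : Fin (m + 1) → Set T) =
        mtype k (D' p) (Fin.cons A' V')) →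
      mtype k (⋃ p, D p) (Fin.cons A V : Fin (m + 1) → Set T) =
        mtype k (⋃ p, D' p) (Fin.cons A' V'))
    (h : ∀ p, mtype (k + 1) (D p) V = mtype (k + 1) (D' p) V') (A : Set T) :
    ∃ A' : Set T, mtype k (⋃ p, D' p) (Fin.cons A' V' : Fin (m + 1) → Set T) =
      mtype k (⋃ p, D p) (Fin.cons A V) := by
  choose A' hA' using fun p => exists_mtype_cons (h p) A
  refine ⟨⋃ p, A' p ∩ D' p, (ih _ _ fun p => ?_).symm⟩
  rw [← hA' p]
  refine mtype_congr (Fin.cases (fun x hx => ?_) (fun i x _ => Iff.rfl))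
  simp only [Fin.cons_zero, Set.mem_iUnion, Set.mem_inter_iff]
  constructor
  · exact fun hxA => ⟨p, hxA, hx⟩
  · rintro ⟨q, hxq, hq⟩
    obtain rfl := hD'.1 p q x hx hq
    exact hxq

/-- The type of a union of parts is determined by the types of the parts. -/
theorem mtype_iUnion {k : ℕ} (hD : IsPiecewise D R (V s)) (hD' : IsPiecewise D' R (V' s))
    (h : ∀ p, mtype k (D p) V = mtype k (D' p) V') :
    mtype k (⋃ p, D p) V = mtype k (⋃ p, D' p) V' := by
  induction k generalizing m with
  | zero =>
    simp only [mtype_zero_eq_iff] at h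
    rw [mtype_zero_eq_iff]
    refine ⟨fun i j => ?_, fun i j => ?_, fun i => ?_⟩
    · have : ∀ (D : I → Set T) (V : Fin m → Set T), (∃ x ∈ ⋃ p, D p, x ∈ V i ∧ x ∈ V j) ↔
          ∃ p, ∃ x ∈ D p, x ∈ V i ∧ x ∈ V j := by
        intro D V
        simp only [Set.mem_iUnion]
        exact ⟨fun ⟨x, ⟨p, hp⟩, hx⟩ => ⟨p, x, hp, hx⟩, fun ⟨p, x, hp, hx⟩ => ⟨x, ⟨p, hp⟩, hx⟩⟩
      rw [this, this]
      exact exists_congr fun p => (h p).1 i j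
    · rw [exists_le_iff_of_isPiecewise hD, exists_le_iff_of_isPiecewise hD']
      refine or_congr (exists_congr fun p => (h p).2.1 i j) ?_
      exact exists_congr fun p => exists_congr fun q => and_congr_right fun _ =>
        and_congr_right fun _ => and_congr ((h p).1 i s) ((h q).1 j j)
    · rw [subsingleton_iff_of_isPiecewise hD, subsingleton_iff_of_isPiecewise hD']
      refine and_congr (forall_congr' fun p => (h p).2.2 i) ?_
      exact forall_congr' fun p => forall_congr' fun q =>
        imp_congr ((h p).1 i i) (imp_congr ((h q).1 i i) Iff.rfl)
  | succ k ih =>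
    have ih' : ∀ A A' : Set T,
        (∀ p, mtype k (D p) (Fin.cons A V : Fin (m + 1) → Set T) =
          mtype k (D' p) (Fin.cons A' V')) →
        mtype k (⋃ p, D p) (Fin.cons A V : Fin (m + 1) → Set T) =
          mtype k (⋃ p, D' p) (Fin.cons A' V') := fun A A' hA =>
      ih (s := s.succ) (by simpa using hD) (by simpa using hD') hA
    exact mtype_succ_eq (exists_mtype_cons_iUnion hD' ih' h)
      (exists_mtype_cons_iUnion hD (fun A A' hA => (ih' A' A fun p => (hA p).symm).symm)
        fun p => (h p).symm)

end Composition

/-! ### Types determine satisfaction -/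

/-- The quantifier depth of a formula. -/
def Formula.depth : {n m : ℕ} → Formula n m → ℕ
  | _, _, .le _ _ => 0
  | _, _, .eq _ _ => 0
  | _, _, .mem _ _ => 0
  | _, _, .neg φ => φ.depth
  | _, _, .and φ ψ => max φ.depth ψ.depth
  | _, _, .exElem φ => φ.depth + 1
  | _, _, .exSet φ => φ.depth + 1

/-- Being a singleton is visible in the `0`-type: the set meets itself, and any two of its elements
agree. -/
theorem eq_singleton_of_mtype {k m : ℕ} {U U' : Fin m → Set T} {i : Fin m} {a : T}
    (h : mtype k Set.univ U = mtype k Set.univ U') (hU : U i = {a}) : ∃ b, U' i = {b} := by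
  obtain ⟨h1, -, h3⟩ := mtype_zero_eq_iff.1 (mtype_zero_of_mtype h)
  obtain ⟨b, -, hb, -⟩ := (h1 i i).1 ⟨a, trivial, by simp [hU], by simp [hU]⟩
  have := (h3 i).1 (by simp [hU])
  refine ⟨b, Set.eq_singleton_iff_unique_mem.2 ⟨hb, fun c hc => this c trivial b trivial hc hb⟩⟩

/-- One sequence `U` interprets both kinds of variables, elements as singletons through `e` and sets
through `s`. Each quantifier of either kind then costs one set move. -/
theorem Formula.realize_congr {n m : ℕ} (φ : Formula n m) : ∀ {k M : ℕ} (e : Fin n → Fin M)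
    (s : Fin m → Fin M) (U U' : Fin M → Set T) (v v' : Fin n → T), φ.depth ≤ k →
    mtype k Set.univ U = mtype k Set.univ U' → (∀ i, U (e i) = {v i}) →
    (∀ i, U' (e i) = {v' i}) → φ.Realize v (U ∘ s) → φ.Realize v' (U' ∘ s) := by
  have key : ∀ {k M : ℕ} {U U' : Fin M → Set T}, mtype k Set.univ U = mtype k Set.univ U' →
      (∀ i j, (∃ x, x ∈ U i ∧ x ∈ U j) ↔ ∃ x, x ∈ U' i ∧ x ∈ U' j) ∧
      (∀ i j, (∃ x y, x ∈ U i ∧ y ∈ U j ∧ x ≤ y) ↔ ∃ x y, x ∈ U' i ∧ y ∈ U' j ∧ x ≤ y) := by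
    intro k M U U' h
    have := mtype_zero_eq_iff.1 (mtype_zero_of_mtype h)
    simp only [Set.mem_univ, true_and] at this
    exact ⟨this.1, this.2.1⟩
  induction φ with
  | le i j =>
    intro k M e s U U' v v' _ h hv hv' H
    have := (key h).2 (e i) (e j)
    simp only [hv, hv', Set.mem_singleton_iff] at this
    exact (by simpa using this : v i ≤ v j ↔ v' i ≤ v' j).1 H
  | eq i j =>
    intro k M e s U U' v v' _ h hv hv' H
    have := (key h).1 (e i) (e j)
    simp only [hv, hv', Set.mem_singleton_iff, exists_eq_left] at this
    exact this.1 H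
  | mem i j =>
    intro k M e s U U' v v' _ h hv hv' H
    have := (key h).1 (e i) (s j)
    simp only [hv, hv', Set.mem_singleton_iff, exists_eq_left] at this
    exact this.1 H
  | neg φ ih =>
    intro k M e s U U' v v' hk h hv hv' H H'
    exact H (ih e s U' U v' v hk h.symm hv' hv H')
  | and φ ψ ih ih' =>
    intro k M e s U U' v v' hk h hv hv' H
    exact ⟨ih e s U U' v v' ((le_max_left _ _).trans hk) h hv hv' H.1,
      ih' e s U U' v v' ((le_max_right _ _).trans hk) h hv hv' H.2⟩
  | exElem φ ih =>
    rintro (_ | k) M e s U U' v v' hk h hv hv' ⟨a, H⟩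
    · simp [Formula.depth] at hk
    obtain ⟨A', hA'⟩ := exists_mtype_cons h {a}
    obtain ⟨b, hb⟩ := eq_singleton_of_mtype (i := 0) hA'.symm (a := a) (by simp)
    refine ⟨b, ?_⟩
    refine ih (Fin.cons 0 (Fin.succ ∘ e)) (Fin.succ ∘ s) (Fin.cons {a} U) (Fin.cons A' U')
      (Fin.cons a v) (Fin.cons b v') (Nat.le_of_succ_le_succ hk) hA'.symm ?_ ?_ H
    · exact Fin.cases (by simp) (fun i => by simpa using hv i)
    · exact Fin.cases (by simpa using hb) (fun i => by simpa using hv' i)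
  | exSet φ ih =>
    rintro (_ | k) M e s U U' v v' hk h hv hv' ⟨A, H⟩
    · simp [Formula.depth] at hk
    obtain ⟨A', hA'⟩ := exists_mtype_cons h A
    refine ⟨A', ?_⟩
    rw [cons_comp_lift] at H ⊢
    exact ih (Fin.succ ∘ e) _ (Fin.cons A U) (Fin.cons A' U') v v' (Nat.le_of_succ_le_succ hk)
      hA'.symm (by simpa using hv) (by simpa using hv') H

end Types

/-! ### Alternating patterns -/

/-- The interval `[x, y]` contains an increasing sequence such that every interval between two
consecutive terms contains, in the reverse order, a pattern of smaller height. -/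
def HasPattern : ℕ → ∀ (α : Type u) [LinearOrder α], α → α → Prop
  | 0, _, _, _, _ => True
  | n + 1, α, _, x, y => ∃ z : ℕ → α, StrictMono z ∧ (∀ i, z i ∈ Set.Icc x y) ∧
      ∀ i, HasPattern n αᵒᵈ (OrderDual.toDual (z (i + 1))) (OrderDual.toDual (z i))

theorem HasPattern.mono {n : ℕ} {α : Type u} [LinearOrder α] {x x' y y' : α} (hx : x' ≤ x)
    (hy : y ≤ y') (h : HasPattern n α x y) : HasPattern n α x' y' := by
  cases n with
  | zero => trivial
  | succ n =>
    obtain ⟨z, hz, hz', h⟩ := h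
    exact ⟨z, hz, fun i => Set.Icc_subset_Icc hx hy (hz' i), h⟩

/-- Every rational interval contains an increasing sequence, and negation turns the reversed gaps
into rational intervals again. -/
theorem hasPattern_of_strictMono_rat {n : ℕ} {α : Type u} [LinearOrder α] {g : ℚ → α}
    (hg : StrictMono g) {a b : ℚ} (hab : a < b) : HasPattern n α (g a) (g b) := by
  induction n generalizing α a b with
  | zero => trivial
  | succ n ih =>
    obtain ⟨u, hu, hu', -⟩ := exists_seq_strictMono_tendsto' hab
    refine ⟨g ∘ u, hg.comp hu,
      fun i => ⟨hg.monotone (hu' i).1.le, hg.monotone (hu' i).2.le⟩, fun i => ?_⟩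
    have hg' : StrictMono fun q : ℚ => OrderDual.toDual (g (-q)) := fun p q hpq =>
      OrderDual.toDual_lt_toDual.2 (hg (neg_lt_neg hpq))
    simpa using ih hg' (neg_lt_neg (hu (Nat.lt_succ_self i)))

/-! ### Ramsey's theorem for pairs -/

/-- For a non-principal ultrafilter `U`, the row `c i` has a `U`-almost constant colour `g i`, and
`g` itself is almost constant with value `k`. The indices are then picked greedily from sets in `U`.
-/
theorem exists_strictMono_homogeneous {C : Type*} [Finite C] (c : ℕ → ℕ → C) :
    ∃ φ : ℕ → ℕ, StrictMono φ ∧ ∃ k, ∀ i j, i < j → c (φ i) (φ j) = k := by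
  let U := Filter.hyperfilter ℕ
  have pigeonhole : ∀ f : ℕ → C, ∃ k, ∀ᶠ j in (U : Filter ℕ), f j = k := by
    intro f
    obtain ⟨k, hk⟩ := (U.map f).eq_pure_of_finite
    refine ⟨k, ?_⟩
    have : ({k} : Set C) ∈ U.map f := by rw [hk]; exact Ultrafilter.mem_pure.2 rfl
    exact this
  have hgt : ∀ n : ℕ, ∀ᶠ j in (U : Filter ℕ), n < j := fun n =>
    Nat.hyperfilter_le_atTop (Filter.eventually_gt_atTop n)
  choose g hg using fun i => pigeonhole (c i)
  obtain ⟨k, hk⟩ := pigeonhole g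
  obtain ⟨φ, -, hφ⟩ := exists_seq_of_forall_finset_exists (fun i => g i = k)
    (fun i j => i < j ∧ c i j = k) (fun s hs => by
      have h1 : ∀ᶠ j in (U : Filter ℕ), ∀ i ∈ s, i < j ∧ c i j = k := by
        rw [Filter.eventually_all_finset]
        intro i hi
        filter_upwards [hgt i, hg i] with j hj hj'
        exact ⟨hj, hj'.trans (hs i hi)⟩
      exact (hk.and h1).exists)
  exact ⟨φ, fun i j hij => (hφ i j hij).1, k, fun i j hij => (hφ i j hij).2⟩

/-! ### Coherent colourings -/

section Colouring

variable {S : Type*} {α : Type u} [LinearOrder α]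

/-- The colour of `(x, z)` is determined by the colours of `(x, y)` and `(y, z)`. -/
def Coherent (c : α → α → S) : Prop :=
  ∀ ⦃x y z x' y' z' : α⦄, x < y → y < z → x' < y' → y' < z' → c x y = c x' y' →
    c y z = c y' z' → c x z = c x' z'

/-- There is a copy of the integers whose consecutive pairs all have the same colour. -/
def HasHomogeneousInt (c : α → α → S) : Prop :=
  ∃ w : ℤ → α, StrictMono w ∧ ∃ f, ∀ i, c (w i) (w (i + 1)) = f

/-- The colouring induced on the order dual. -/
def dualColouring (c : α → α → S) (a b : αᵒᵈ) : S :=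
  c (OrderDual.ofDual b) (OrderDual.ofDual a)

/-- The element `z` splits a subinterval of `[x, y]` of the idempotent colour `g` into two
intervals of colour `g`. -/
def Splits (c : α → α → S) (x y z : α) (g : S) : Prop :=
  ∃ a b, x ≤ a ∧ a < z ∧ z < b ∧ b ≤ y ∧ c a z = g ∧ c z b = g ∧ c a b = g

/-- The colour `f` absorbs the colour `g` from both sides. -/
def Absorbs (c : α → α → S) (f g : S) : Prop :=
  (∃ p q r, p < q ∧ q < r ∧ c p q = f ∧ c q r = g ∧ c p r = f) ∧
    ∃ p q r, p < q ∧ q < r ∧ c p q = g ∧ c q r = f ∧ c p r = f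

/-- The element `z` of `(x, y)` starts an increasing sequence homogeneous for the colour `f`,
which absorbs all colours in `F`, and `z` splits intervals of each colour in `F`. -/
def IsApex (c : α → α → S) (x y : α) (F : Finset S) (f : S) (z : α) : Prop :=
  z ∈ Set.Ioo x y ∧ (∀ g ∈ F, Splits c x y z g) ∧ (∀ g ∈ F, Absorbs c f g) ∧
    ∃ w : ℕ → α, StrictMono w ∧ w 0 = z ∧ ∀ i j, i < j → c (w i) (w j) = f

theorem Coherent.dual {c : α → α → S} (hc : Coherent c) : Coherent (dualColouring c) :=
  fun _ _ _ _ _ _ h1 h2 h3 h4 h h' => hc h2 h1 h4 h3 h' h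

theorem HasHomogeneousInt.of_dual {c : α → α → S} (h : HasHomogeneousInt (dualColouring c)) :
    HasHomogeneousInt c := by
  obtain ⟨w, hw, f, hf⟩ := h
  refine ⟨fun i => OrderDual.ofDual (w (-i)), fun i j hij => hw (neg_lt_neg hij), f, fun i => ?_⟩
  have := hf (-(i + 1))
  rw [neg_add, neg_add_cancel_right] at this
  change c (OrderDual.ofDual (w (-i))) (OrderDual.ofDual (w (-(i + 1)))) = f
  rw [neg_add]
  exact this

theorem Splits.of_dual {c : α → α → S} {x y z : α} {g : S}
    (h : Splits (dualColouring c) (OrderDual.toDual y) (OrderDual.toDual x)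
      (OrderDual.toDual z) g) : Splits c x y z g := by
  obtain ⟨a, b, h1, h2, h3, h4, h5, h6, h7⟩ := h
  exact ⟨OrderDual.ofDual b, OrderDual.ofDual a, h4, h3, h2, h1, h6, h5, h7⟩

theorem Absorbs.of_dual {c : α → α → S} {f g : S} (h : Absorbs (dualColouring c) f g) :
    Absorbs c f g := by
  obtain ⟨⟨p, q, r, h1, h2, h3, h4, h5⟩, p', q', r', h1', h2', h3', h4', h5'⟩ := h
  exact ⟨⟨OrderDual.ofDual r', OrderDual.ofDual q', OrderDual.ofDual p', h2', h1', h4', h3', h5'⟩,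
    OrderDual.ofDual r, OrderDual.ofDual q, OrderDual.ofDual p, h2, h1, h4, h3, h5⟩

/-- Writing colours of composed intervals as products, `f = f * g` by one hypothesis and `f * g = g`
by the other. -/
theorem Absorbs.antisymm {c : α → α → S} (hc : Coherent c) {f g : S} (h : Absorbs c f g)
    (h' : Absorbs c g f) : f = g := by
  obtain ⟨p, q, r, h1, h2, h3, h4, h5⟩ := h.1
  obtain ⟨p', q', r', h1', h2', h3', h4', h5'⟩ := h'.2
  rw [← h5, ← h5']
  exact hc h1 h2 h1' h2' (h3.trans h3'.symm) (h4.trans h4'.symm)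

/-- Two homogeneous sequences of the same colour, one increasing and one decreasing, starting
at the same element, form a copy of the integers. -/
theorem hasHomogeneousInt_of_rays {c : α → α → S} {f : S} {w v : ℕ → α} (hw : StrictMono w)
    (hv : StrictAnti v) (h0 : w 0 = v 0) (hwf : ∀ i j, i < j → c (w i) (w j) = f)
    (hvf : ∀ i j, i < j → c (v j) (v i) = f) : HasHomogeneousInt c := by
  let W : ℤ → α := fun i => if 0 ≤ i then w i.toNat else v (-i).toNat
  have key : ∀ i, W i < W (i + 1) ∧ c (W i) (W (i + 1)) = f := by
    intro i
    by_cases hi : 0 ≤ i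
    · have h1 : W i = w i.toNat := if_pos hi
      have h2 : W (i + 1) = w (i.toNat + 1) := by
        have : (i + 1).toNat = i.toNat + 1 := by omega
        rw [← this]; exact if_pos (by omega)
      rw [h1, h2]
      exact ⟨hw (Nat.lt_succ_self _), hwf _ _ (Nat.lt_succ_self _)⟩
    · have h1 : W i = v ((-(i + 1)).toNat + 1) := by
        have : (-i).toNat = (-(i + 1)).toNat + 1 := by omega
        rw [← this]; exact if_neg hi
      have h2 : W (i + 1) = v (-(i + 1)).toNat := by
        by_cases hi' : 0 ≤ i + 1
        · obtain rfl : i = -1 := by omega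
          exact h0
        · exact if_neg hi'
      rw [h1, h2]
      exact ⟨hv (Nat.lt_succ_self _), hvf _ _ (Nat.lt_succ_self _)⟩
  exact ⟨W, strictMono_int_of_lt_succ fun i => (key i).1, f, fun i => (key i).2⟩

/-- An apex of a homogeneous increasing sequence whose terms lie in consecutive blocks. -/
theorem isApex_of_blocks {c : α → α → S} (hc : Coherent c) [DecidableEq S] {x y : α}
    {F : Finset S} {f : S} {p a b : ℕ → α} (hxa : ∀ i, x ≤ a i) (hby : ∀ i, b i ≤ y)
    (hap : ∀ i, a i ≤ p i) (hpb : ∀ i, p i ≤ b i) (hpa : ∀ i, p i < a (i + 1))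
    (hbp : ∀ i, b i < p (i + 1)) (hF : ∀ i, ∀ g ∈ F, Splits c (a i) (b i) (p i) g)
    (hf : ∀ i j, i < j → c (p i) (p j) = f) : IsApex c x y (insert f F) f (p 1) := by
  have hp : StrictMono p := strictMono_nat_of_lt_succ fun i => (hpb i).trans_lt (hbp i)
  -- The apex is `p 1` rather than `p 0`, so that `p 0` is available on its left for splitting and
  -- absorbing.
  refine ⟨⟨((hxa 0).trans (hap 0)).trans_lt (hp Nat.zero_lt_one),
    (hp (Nat.lt_succ_self 1)).trans_le ((hpb 2).trans (hby 2))⟩, fun g hg => ?_, fun g hg => ?_,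
    fun i => p (i + 1), fun i j hij => hp (Nat.succ_lt_succ hij), rfl,
    fun i j hij => hf _ _ (Nat.succ_lt_succ hij)⟩
  · rcases Finset.mem_insert.1 hg with rfl | hg
    · exact ⟨p 0, p 2, (hxa 0).trans (hap 0), hp Nat.zero_lt_one, hp (Nat.lt_succ_self 1),
        (hpb 2).trans (hby 2), hf _ _ Nat.zero_lt_one, hf _ _ (Nat.lt_succ_self 1),
        hf _ _ Nat.zero_lt_two⟩
    · obtain ⟨u, v, h1, h2, h3, h4, h⟩ := hF 1 g hg
      exact ⟨u, v, (hxa 1).trans h1, h2, h3, h4.trans (hby 1), h⟩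
  · rcases Finset.mem_insert.1 hg with rfl | hg
    · have : p 0 < p 1 ∧ p 1 < p 2 ∧ c (p 0) (p 1) = g ∧ c (p 1) (p 2) = g ∧ c (p 0) (p 2) = g :=
        ⟨hp Nat.zero_lt_one, hp (Nat.lt_succ_self 1), hf _ _ Nat.zero_lt_one,
          hf _ _ (Nat.lt_succ_self 1), hf _ _ Nat.zero_lt_two⟩
      exact ⟨⟨_, _, _, this⟩, _, _, _, this⟩
    · have h01 := hf 0 1 Nat.zero_lt_one
      have hp01 := hp Nat.zero_lt_one
      constructor
      -- The intervals from `u` to `p 1` and from `u` to `v` both have colour `g`. Replacing one by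
      -- the other after the interval from `p 0` to `u` leaves the total colour `f` unchanged. The
      -- other side is symmetric.
      · obtain ⟨u, v, h1, h2, h3, h4, h5, h6, h7⟩ := hF 1 g hg
        have hu : p 0 < u := (hpa 0).trans_le h1
        refine ⟨p 0, p 1, v, hp01, h3, h01, h6, ?_⟩
        rw [← h01]
        exact hc hu (h2.trans h3) hu h2 rfl (h7.trans h5.symm)
      · obtain ⟨u, v, h1, h2, h3, h4, h5, h6, h7⟩ := hF 0 g hg
        have hv : v < p 1 := h4.trans_lt (hbp 0)
        refine ⟨u, p 0, p 1, h2, hp01, h5, h01, ?_⟩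
        rw [← h01]
        exact hc (h2.trans h3) hv h3 hv (h7.trans h6.symm) rfl

/-- A pattern of height `n + 1` yields a homogeneous copy of the integers or an apex with
`n + 1` colours. -/
theorem HasPattern.exists_isApex [Finite S] [DecidableEq S] {n : ℕ} {c : α → α → S}
    (hc : Coherent c) {x y : α} (h : HasPattern (n + 1) α x y) :
    HasHomogeneousInt c ∨ ∃ (F : Finset S) (f : S) (z : α),
      f ∈ F ∧ F.card = n + 1 ∧ IsApex c x y F f z := by
  have : Fintype S := Fintype.ofFinite S
  induction n generalizing α with
  | zero =>
    obtain ⟨z, hz, hz', -⟩ := h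
    obtain ⟨φ, hφ, f, hf⟩ := exists_strictMono_homogeneous fun i j => c (z i) (z j)
    refine Or.inr ⟨insert f ∅, f, z (φ 1), by simp, by simp, ?_⟩
    have hφ' : ∀ i, z (φ i) < z (φ (i + 1)) := fun i => hz (hφ (Nat.lt_succ_self i))
    exact isApex_of_blocks hc (p := z ∘ φ) (a := z ∘ φ) (b := z ∘ φ) (fun i => (hz' _).1)
      (fun i => (hz' _).2) (fun i => le_rfl) (fun i => le_rfl) hφ' hφ' (by simp) hf
  | succ n ih =>
    by_contra! hcon
    obtain ⟨hZ, hcon⟩ := hcon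
    obtain ⟨z, hz, hz', hP⟩ := h
    have hex : ∀ i, ∃ (F : Finset S) (f : S) (p : αᵒᵈ), f ∈ F ∧ F.card = n + 1 ∧
        IsApex (dualColouring c) (OrderDual.toDual (z (i + 1))) (OrderDual.toDual (z i)) F f p :=
      fun i => (ih hc.dual (hP i)).resolve_left fun H => hZ H.of_dual
    choose F f p hfF hFn hp using hex
    -- Besides the colours between apexes, the set and the ray colour attached to each apex are made
    -- constant.
    obtain ⟨φ, hφ, ⟨f', F', f''⟩, hhom⟩ := exists_strictMono_homogeneous fun i j =>
      ((c (OrderDual.ofDual (p i)) (OrderDual.ofDual (p j)), F i, f i) : S × Finset S × S)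
    simp only [Prod.mk.injEq] at hhom
    have hF' : ∀ i, F (φ i) = F' := fun i => (hhom i (i + 1) (Nat.lt_succ_self i)).2.1
    have hf'' : ∀ i, f (φ i) = f'' := fun i => (hhom i (i + 1) (Nat.lt_succ_self i)).2.2
    have hle : ∀ i, z (φ i + 1) ≤ z (φ (i + 1)) := fun i =>
      hz.monotone (hφ (Nat.lt_succ_self i))
    have hzp : ∀ i, z i < OrderDual.ofDual (p i) := fun i => (hp i).1.2
    have hpz : ∀ i, OrderDual.ofDual (p i) < z (i + 1) := fun i => (hp i).1.1
    have apex : IsApex c x y (insert f' F') f' (OrderDual.ofDual (p (φ 1))) := by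
      refine isApex_of_blocks hc (p := fun i => OrderDual.ofDual (p (φ i)))
        (a := fun i => z (φ i)) (b := fun i => z (φ i + 1)) (fun i => (hz' _).1)
        (fun i => (hz' _).2) (fun i => (hzp _).le) (fun i => (hpz _).le)
        (fun i => (hpz _).trans_le (hle i)) (fun i => (hle i).trans_lt (hzp _)) ?_
        (fun i j hij => (hhom i j hij).1)
      intro i g hg
      exact Splits.of_dual ((hp (φ i)).2.1 g (by rwa [hF']))
    have ⟨_, _, habs, w, hw, hw0, hwf⟩ := apex
    -- If `f'` is old, `f'` and `f''` absorb each other and so coincide; the increasing ray of the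
    -- new apex and the decreasing ray of the block's apex start at the same point and form a copy
    -- of the integers. If `f'` is new, the set of colours has grown.
    by_cases hmem : f' ∈ F'
    · have h1 : Absorbs c f'' f' := by
        have := (hp (φ 1)).2.2.1 f' (by rwa [hF'])
        rw [hf''] at this
        exact this.of_dual
      have h2 : Absorbs c f' f'' := by
        refine habs f'' (Finset.mem_insert_of_mem ?_)
        rw [← hF' 0, ← hf'' 0]
        exact hfF _
      obtain rfl := h1.antisymm hc h2
      obtain ⟨v, hv, hv0, hvf⟩ := (hp (φ 1)).2.2.2
      refine hZ (hasHomogeneousInt_of_rays (v := fun i => OrderDual.ofDual (v i)) hw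
        (fun i j hij => hv hij) (by rw [hw0, hv0]) hwf fun i j hij => ?_)
      rw [← hf'' 1]
      exact hvf i j hij
    · refine hcon _ f' _ (Finset.mem_insert_self _ _) ?_ apex
      rw [Finset.card_insert_of_notMem hmem, ← hF' 0, hFn]

theorem HasPattern.hasHomogeneousInt [Finite S] {n : ℕ} {c : α → α → S}
    (hc : Coherent c) {x y : α} (hn : Nat.card S ≤ n) (h : HasPattern (n + 1) α x y) :
    HasHomogeneousInt c := by
  classical
  have : Fintype S := Fintype.ofFinite S
  refine (h.exists_isApex hc).resolve_right ?_
  rintro ⟨F, f, z, -, hF, -⟩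
  have := Finset.card_le_univ F
  rw [Nat.card_eq_fintype_card] at hn
  omega

end Colouring

/-! ### Intervals without patterns have finite degree -/

section FiniteDegree

/-- The set `C` can be decomposed `n` times along (inversely) well ordered sums into finite
pieces. -/
def HasDegreeLE {α : Type u} [LinearOrder α] : ℕ → Set α → Prop
  | 0, C => C.Finite
  | n + 1, C => ∃ (I : Type u) (_ : LinearOrder I) (π : α → I),
      (WellFoundedLT I ∨ WellFoundedGT I) ∧ MonotoneOn π C ∧
        ∀ i, HasDegreeLE n (C ∩ π ⁻¹' {i})

variable {α : Type u} [LinearOrder α]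

theorem HasDegreeLE.subset {n : ℕ} {C C' : Set α} (h : HasDegreeLE n C) (hC : C' ⊆ C) :
    HasDegreeLE n C' := by
  induction n generalizing C C' with
  | zero => exact Set.Finite.subset h hC
  | succ n ih =>
    obtain ⟨I, hI, π, hwf, hπ, hd⟩ := h
    exact ⟨I, hI, π, hwf, hπ.mono hC, fun i => ih (hd i) (Set.inter_subset_inter_left _ hC)⟩

theorem hasDegreeLE_dual {n : ℕ} {C : Set αᵒᵈ} (h : HasDegreeLE n C) :
    HasDegreeLE n (OrderDual.toDual ⁻¹' C) := by
  induction n generalizing C with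
  | zero => exact h
  | succ n ih =>
    obtain ⟨I, hI, π, hwf, hπ, hd⟩ := h
    refine ⟨Iᵒᵈ, inferInstance, fun a => OrderDual.toDual (π (OrderDual.toDual a)), ?_, ?_, ?_⟩
    · rcases hwf with h | h
      · exact Or.inr inferInstance
      · exact Or.inl inferInstance
    · exact fun a ha b hb hab => hπ hb ha hab
    · exact fun i => ih (hd i)

theorem hasDegreeLE_of_finite {n : ℕ} {C : Set α} (h : C.Finite) : HasDegreeLE n C := by
  induction n generalizing C with
  | zero => exact h
  | succ n ih =>
    exact ⟨PUnit, inferInstance, fun _ => PUnit.unit, Or.inl inferInstance,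
      fun _ _ _ _ _ => le_rfl, fun i => ih (h.subset Set.inter_subset_left)⟩

/-- A chain all of whose proper initial parts have small degree. -/
theorem hasDegreeLE_succ_of_Iic {n : ℕ} {C : Set α}
    (h : ∀ w ∈ C, HasDegreeLE n (C ∩ Set.Iic w)) : HasDegreeLE (n + 1) C := by
  classical
  rcases C.eq_empty_or_nonempty with rfl | ⟨w₀, hw₀⟩
  · exact hasDegreeLE_of_finite Set.finite_empty
  let r : α → α → Prop := WellOrderingRel
  have hr : WellFounded r := IsWellFounded.wf
  -- `π y` will be the least bound of `y` in `C` for a well-order unrelated to `≤`. A larger `y` has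
  -- fewer bounds, so `π` is monotone. The second set is a filler for those `y` above all of `C`.
  have hne : ∀ y : α, ({w | w ∈ C ∧ y ≤ w} ∪ {w | w ∈ C ∧ ∀ w' ∈ C, w' < y}).Nonempty := by
    intro y
    by_cases hy : ∃ w ∈ C, y ≤ w
    · obtain ⟨w, hw⟩ := hy
      exact ⟨w, Or.inl hw⟩
    · push Not at hy
      exact ⟨w₀, Or.inr ⟨hw₀, hy⟩⟩
  let π : α → α := fun y => hr.min _ (hne y)
  have hπ : ∀ y ∈ C, π y ∈ C ∧ y ≤ π y := by
    intro y hy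
    rcases hr.min_mem _ (hne y) with h | h
    · exact h
    · exact absurd (h.2 y hy) (lt_irrefl _)
  refine ⟨α, linearOrderOfSTO r, π, Or.inl ⟨hr⟩, fun x hx y hy hxy => ?_, fun i => ?_⟩
  · refine (@not_lt _ (linearOrderOfSTO r) _ _).1 fun hlt => ?_
    exact hr.not_lt_min {w | w ∈ C ∧ x ≤ w ∨ w ∈ C ∧ ∀ w' ∈ C, w' < x}
      (Or.inl ⟨(hπ y hy).1, hxy.trans (hπ y hy).2⟩) hlt
  · by_cases hi : i ∈ C
    · refine (h i hi).subset ?_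
      rintro y ⟨hy, rfl⟩
      exact ⟨hy, (hπ y hy).2⟩
    · refine (h w₀ hw₀).subset ?_
      rintro y ⟨hy, rfl⟩
      exact absurd (hπ y hy).1 hi

theorem hasDegreeLE_succ_of_Ici {n : ℕ} {C : Set α}
    (h : ∀ w ∈ C, HasDegreeLE n (C ∩ Set.Ici w)) : HasDegreeLE (n + 1) C := by
  refine hasDegreeLE_dual (C := OrderDual.ofDual ⁻¹' C) (hasDegreeLE_succ_of_Iic fun w hw => ?_)
  exact hasDegreeLE_dual (α := αᵒᵈ) (h w hw)

/-- One level removes the lower end point and one the upper. -/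
theorem hasDegreeLE_of_Icc {n : ℕ} {C : Set α}
    (h : ∀ x ∈ C, ∀ y ∈ C, HasDegreeLE n (C ∩ Set.Icc x y)) : HasDegreeLE (n + 2) C := by
  refine hasDegreeLE_succ_of_Ici fun x hx => hasDegreeLE_succ_of_Iic fun y hy => ?_
  refine (h x hx y hy.1).subset ?_
  rintro z ⟨⟨h1, h2⟩, h3⟩
  exact ⟨h1, h2, h3⟩

/-- Reachability by finitely many steps upwards along the complement of `H`. -/
def LightPath (H : α → α → Prop) : α → α → Prop :=
  Relation.ReflTransGen fun a b => a ≤ b ∧ ¬ H a b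

section LightPath

variable {H : α → α → Prop}

theorem LightPath.le {x y : α} (h : LightPath H x y) : x ≤ y := by
  induction h with
  | refl => exact le_rfl
  | tail _ h ih => exact ih.trans h.1

/-- A point `y` inside a light step divides it into two steps, which are light because `H` is
inherited by larger intervals. -/
theorem LightPath.split (hH : ∀ ⦃x x' y y'⦄, x' ≤ x → y ≤ y' → H x y → H x' y') {x y z : α}
    (h : LightPath H x z) (hxy : x ≤ y) (hyz : y ≤ z) : LightPath H x y ∧ LightPath H y z := by
  induction h with
  | refl =>
    obtain rfl := le_antisymm hxy hyz
    exact ⟨.refl, .refl⟩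
  | @tail b c h h' ih =>
    rcases le_total y b with hyb | hby
    · exact ⟨(ih hyb).1, (ih hyb).2.tail h'⟩
    · exact ⟨Relation.ReflTransGen.tail h ⟨hby, fun H' => h'.2 (hH le_rfl hyz H')⟩,
        .single ⟨hyz, fun H' => h'.2 (hH hby le_rfl H')⟩⟩

/-- The vertices of the path cut `[x, y]` into finitely many `H`-free intervals, which `π` numbers
in order. The bound `N` supplies a fresh number for the next interval. -/
theorem LightPath.hasDegreeLE {d : ℕ}
    (hd : ∀ a b, a ≤ b → ¬ H a b → HasDegreeLE d (Set.Icc a b)) {x y : α}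
    (h : LightPath H x y) : HasDegreeLE (d + 1) (Set.Icc x y) := by
  have key : ∃ π : α → ℕ, Monotone π ∧ (∃ N, ∀ a, π a ≤ N) ∧
      ∀ i, HasDegreeLE d (Set.Icc x y ∩ π ⁻¹' {i}) := by
    induction h with
    | refl =>
      refine ⟨fun _ => 0, fun _ _ _ => le_rfl, ⟨0, fun _ => le_rfl⟩, fun i => ?_⟩
      exact hasDegreeLE_of_finite (by simpa using (Set.finite_singleton x).inter_of_left _)
    | @tail b c hb hbc ih =>
      obtain ⟨π, hπ, ⟨N, hN⟩, hi⟩ := ih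
      refine ⟨fun a => if a < b then π a else N + 1, fun a a' haa' => ?_, ⟨N + 1, fun a => ?_⟩,
        fun i => ?_⟩
      · dsimp only
        split_ifs with h1 h2 h2
        · exact hπ haa'
        · exact (hN a).trans (Nat.le_succ N)
        · exact absurd (haa'.trans_lt h2) h1
        · exact le_rfl
      · dsimp only
        split_ifs
        · exact (hN a).trans (Nat.le_succ N)
        · exact le_rfl
      · by_cases hiN : i = N + 1
        · refine (hd b c hbc.1 hbc.2).subset ?_
          rintro a ⟨ha, hai⟩
          refine ⟨?_, ha.2⟩
          by_contra hab
          have : π a = i := by simpa [not_le.1 hab] using hai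
          have := hN a
          omega
        · refine (hi i).subset ?_
          rintro a ⟨ha, hai⟩
          by_cases hab : a < b
          · exact ⟨⟨ha.1, hab.le⟩, by simpa [hab] using hai⟩
          · have : N + 1 = i := by simpa [hab] using hai
            exact absurd this.symm hiN
  obtain ⟨π, hπ, -, hi⟩ := key
  refine ⟨ULift ℕ, inferInstance, fun a => ⟨π a⟩, Or.inl inferInstance,
    fun a _ b _ hab => hπ hab, fun i => (hi i.down).subset ?_⟩
  rintro a ⟨ha, rfl⟩
  exact ⟨ha, rfl⟩

/-- If there is no infinite ascending sequence of `H`-steps in `[x, y]`, and the intervals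
without an `H`-step have small degree, then so has `[x, y]`. -/
theorem hasDegreeLE_Icc_of_noAscending (hH : ∀ ⦃x x' y y'⦄, x' ≤ x → y ≤ y' → H x y → H x' y')
    {d : ℕ} (hd : ∀ a b, a ≤ b → ¬ H a b → HasDegreeLE d (Set.Icc a b)) {x y : α}
    (hxy : ∀ z : ℕ → α, StrictMono z → (∀ i, z i ∈ Set.Icc x y) → ∃ i, ¬ H (z i) (z (i + 1))) :
    HasDegreeLE (d + 4) (Set.Icc x y) := by
  rcases lt_or_ge y x with hlt | hle
  · exact hasDegreeLE_of_finite (by simp [Set.Icc_eq_empty_of_lt hlt])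
  -- The classes of this relation are convex, and the resulting sum is indexed by one representative
  -- per class.
  let s : Setoid (Set.Icc x y) :=
    { r := fun a b => LightPath H a b ∨ LightPath H b a
      iseqv := by
        refine ⟨fun a => Or.inl .refl, fun h => h.symm, ?_⟩
        rintro a b c (hab | hba) (hbc | hcb)
        · exact Or.inl (hab.trans hbc)
        · rcases le_total (a : α) c with hac | hca
          · exact Or.inl (hab.split hH hac hcb.le).1
          · exact Or.inr (hcb.split hH hca hab.le).1
        · rcases le_total (a : α) c with hac | hca
          · exact Or.inl (hbc.split hH hba.le hac).2
          · exact Or.inr (hba.split hH hbc.le hca).2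
        · exact Or.inr (hcb.trans hba) }
  let rep : Set.Icc x y → Set.Icc x y := fun a => (Quotient.mk s a).out
  have hrep : ∀ a, LightPath H (rep a) a ∨ LightPath H a (rep a) := fun a =>
    Quotient.mk_out (s := s) a
  have hrep_eq : ∀ a b : Set.Icc x y, LightPath H a b → rep a = rep b := fun a b h => by
    have : Quotient.mk s a = Quotient.mk s b := Quotient.sound (Or.inl h)
    simp only [rep, this]
  have hidem : ∀ a, rep (rep a) = rep a := fun a =>
    (hrep a).elim (hrep_eq _ _) fun h => (hrep_eq _ _ h).symm
  have hmono : Monotone rep := by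
    intro a b hab
    by_contra! hlt
    rcases le_or_gt (rep a) b with hb | hb
    · have h1 : LightPath H (rep b) b :=
        (hrep b).resolve_right fun h => (hlt.trans_le hb).not_ge h.le
      have := hrep_eq _ _ (h1.split hH hlt.le hb).1
      rw [hidem, hidem] at this
      exact hlt.ne this
    · have h1 : LightPath H a (rep a) :=
        (hrep a).resolve_left fun h => (hab.trans_lt hb).not_ge h.le
      exact hlt.ne' (hrep_eq _ _ (h1.split hH hab hb.le).1)
  let I := Set.range rep
  -- Successive terms of an increasing sequence of representatives lie in different classes, so each
  -- step satisfies `H`; an infinite such sequence is excluded by `hxy`.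
  have hI : WellFoundedGT I := by
    refine ⟨RelEmbedding.wellFounded_iff_isEmpty.2 ⟨fun f => ?_⟩⟩
    have hf : StrictMono f := fun i j hij => f.map_rel_iff.2 hij
    obtain ⟨i, hi⟩ := hxy (fun i => ((f i : Set.Icc x y) : α)) (fun i j hij => hf hij)
      fun i => (f i).1.2
    have hlt : (f i).1 < (f (i + 1)).1 := hf (Nat.lt_succ_self i)
    obtain ⟨a, ha⟩ := (f i).2
    obtain ⟨b, hb⟩ := (f (i + 1)).2
    have hab := hrep_eq (f i).1 (f (i + 1)).1 (.single ⟨hlt.le, hi⟩)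
    rw [← ha, ← hb, hidem, hidem, ha, hb] at hab
    exact hlt.ne hab
  -- The constant `4`: one level for the sum over classes, two for passing from a class to its
  -- intervals, and one for cutting such an interval along a light path.
  refine ⟨I, inferInstance, fun a => ⟨rep (Set.projIcc x y hle a), _, rfl⟩, Or.inr hI,
    fun a _ b _ hab => hmono (Set.monotone_projIcc hle hab), fun i => hasDegreeLE_of_Icc ?_⟩
  rintro a ⟨ha, rfl⟩ b ⟨hb, hab⟩
  by_cases hle' : a ≤ b
  swap
  · exact hasDegreeLE_of_finite (by simp [Set.Icc_eq_empty hle'])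
  have hab : rep ⟨b, hb⟩ = rep ⟨a, ha⟩ := by
    have := congrArg Subtype.val (Set.mem_singleton_iff.1 hab)
    simpa only [Set.projIcc_of_mem hle ha, Set.projIcc_of_mem hle hb] using this
  have hpath : LightPath H a b := by
    have hq : s.r ⟨a, ha⟩ ⟨b, hb⟩ := by
      have h1 : s.r (rep ⟨a, ha⟩) ⟨a, ha⟩ := hrep _
      have h2 : s.r (rep ⟨b, hb⟩) ⟨b, hb⟩ := hrep _
      rw [hab] at h2
      exact s.trans (s.symm h1) h2
    rcases hq with h | h
    · exact h
    · obtain rfl : a = b := le_antisymm hle' h.le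
      exact .refl
  exact (hpath.hasDegreeLE hd).subset Set.inter_subset_right

end LightPath

/-- Take `H a b` to mean that `[a, b]` contains a reversed pattern of height `n`; an infinite ascent
of `H`-steps is exactly a pattern of height `n + 1`. The bound `d` must be uniform in `α`, since the
induction passes to the dual order. -/
theorem exists_hasDegreeLE_of_not_hasPattern (n : ℕ) : ∃ d : ℕ, ∀ (α : Type u) [LinearOrder α]
    (x y : α), ¬ HasPattern n α x y → HasDegreeLE d (Set.Icc x y) := by
  induction n with
  | zero => exact ⟨0, fun α _ x y h => (h trivial).elim⟩
  | succ n ih =>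
    obtain ⟨d, hd⟩ := ih
    refine ⟨d + 4, fun α _ x y h => ?_⟩
    refine hasDegreeLE_Icc_of_noAscending
      (H := fun a b => HasPattern n αᵒᵈ (OrderDual.toDual b) (OrderDual.toDual a))
      (fun x x' y y' hx hy h => h.mono hy hx) (fun a b _ hab => ?_) (fun z hz hz' => ?_)
    · refine (hasDegreeLE_dual (hd αᵒᵈ _ _ hab)).subset ?_
      exact fun c hc => ⟨hc.2, hc.1⟩
    · by_contra! hcon
      exact h ⟨z, hz, hz', hcon⟩

/-- A linear order all of whose patterns have height less than `n` has bounded degree. -/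
theorem exists_hasDegreeLE_univ (n : ℕ) : ∃ d : ℕ, ∀ (α : Type u) [LinearOrder α],
    (∀ x y : α, ¬ HasPattern n α x y) → HasDegreeLE d (Set.univ : Set α) := by
  obtain ⟨d, hd⟩ := exists_hasDegreeLE_of_not_hasPattern.{u} n
  exact ⟨d + 2, fun α _ h => hasDegreeLE_of_Icc fun x _ y _ =>
    (hd α x y (h x y)).subset Set.inter_subset_right⟩

end FiniteDegree

section Choice

variable {T : Type u} [PartialOrder T] {l : ℕ}

/-! ### Reduction to equality of types -/

/-- The formula does not mention `J`; it is present in the types because the composition theorem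
needs it. -/
theorem holds_of_mtype_eq {k : ℕ} {φ : Formula 1 (l + 1)} (hk : φ.depth ≤ k) {P : Fin l → Set T}
    {J X : Set T} {a b : T}
    (h : mtype k Set.univ (Fin.cons {a} (Fin.cons X (Fin.cons J P)) : Fin (l + 3) → Set T) =
      mtype k Set.univ (Fin.cons {b} (Fin.cons X (Fin.cons J P)))) (ha : Holds φ P a X) :
    Holds φ P b X := by
  have key : ∀ a : T, (Fin.cons {a} (Fin.cons X (Fin.cons J P)) : Fin (l + 3) → Set T) ∘
      (Fin.cons 1 fun i => i.succ.succ.succ : Fin (l + 1) → Fin (l + 3)) = Fin.cons X P := by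
    intro a
    funext i
    refine Fin.cases rfl (fun i => ?_) i
    simp
  have := φ.realize_congr (fun _ => 0)
    (Fin.cons 1 fun i => i.succ.succ.succ : Fin (l + 1) → Fin (l + 3)) _ _ (fun _ => a)
    (fun _ => b) hk h (by simp) (by simp)
  rw [key, key] at this
  exact this ha

/-- The type with a marked element determines the types with other markings by this element. -/
theorem mtype_remark {k m : ℕ} {D D' : Set T} {W : Fin m → Set T} {x x' : T}
    (h : mtype k D (Fin.cons {x} (Fin.cons ∅ W) : Fin (m + 2) → Set T) =
      mtype k D' (Fin.cons {x'} (Fin.cons ∅ W))) (i j : Fin 2) :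
    mtype k D (Fin.cons (![{x}, ∅] i) (Fin.cons (![{x}, ∅] j) W) : Fin (m + 2) → Set T) =
      mtype k D' (Fin.cons (![{x'}, ∅] i) (Fin.cons (![{x'}, ∅] j) W)) := by
  let ι : Fin 2 → Fin (m + 2) := ![0, 1]
  have key : ∀ x : T, (Fin.cons (![{x}, ∅] i) (Fin.cons (![{x}, ∅] j) W) : Fin (m + 2) → Set T) =
      (Fin.cons {x} (Fin.cons ∅ W) : Fin (m + 2) → Set T) ∘
        (Fin.cons (ι i) (Fin.cons (ι j) fun i => i.succ.succ) : Fin (m + 2) → Fin (m + 2)) := by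
    intro x
    have hι : ∀ i, (![{x}, ∅] i : Set T) =
        (Fin.cons {x} (Fin.cons ∅ W) : Fin (m + 2) → Set T) (ι i) := by
      intro i
      fin_cases i <;> rfl
    funext p
    refine Fin.cases (hι i) (fun p => Fin.cases (hι j) (fun p => ?_) p) p
    simp
  rw [key, key]
  exact mtype_comp _ h

theorem mtype_congr_cons {k m : ℕ} {D : Set T} {W : Fin m → Set T} {A A' X X' : Set T}
    (hA : ∀ t ∈ D, t ∈ A ↔ t ∈ A') (hX : ∀ t ∈ D, t ∈ X ↔ t ∈ X') :
    mtype k D (Fin.cons A (Fin.cons X W) : Fin (m + 2) → Set T) =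
      mtype k D (Fin.cons A' (Fin.cons X' W)) :=
  mtype_congr (Fin.cases hA (Fin.cases hX fun _ _ _ => Iff.rfl))

/-! ### Splitting above an initial segment -/

/-- Swapping two similar cones `E₁` and `E₂` above `A` exchanges their marked elements. -/
theorem mtype_swap {k m : ℕ} {W : Fin m → Set T} {s : Fin m} {E₁ E₂ : Set T} {x₁ x₂ : T}
    (hE : Disjoint E₁ E₂) (h₁ : x₁ ∈ E₁) (h₂ : x₂ ∈ E₂)
    (hE₁ : ∀ y ∈ E₁, ∀ z ∉ E₁, (z ≤ y ↔ z ∈ W s) ∧ ¬ y ≤ z)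
    (hE₂ : ∀ y ∈ E₂, ∀ z ∉ E₂, (z ≤ y ↔ z ∈ W s) ∧ ¬ y ≤ z)
    (h : mtype k E₁ (Fin.cons {x₁} (Fin.cons ∅ W) : Fin (m + 2) → Set T) =
      mtype k E₂ (Fin.cons {x₂} (Fin.cons ∅ W))) :
    mtype k Set.univ (Fin.cons {x₁} (Fin.cons {x₁, x₂} W) : Fin (m + 2) → Set T) =
      mtype k Set.univ (Fin.cons {x₂} (Fin.cons {x₁, x₂} W)) := by
  have hE' := Set.disjoint_left.1 hE
  have hE'' := Set.disjoint_right.1 hE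
  -- The tree is divided into the two cones and the rest. The labels `some true` and `some false`
  -- carry the cones in either order, and the relation between labels is the same for both orders.
  let part : Set T → Set T → Option Bool → Set T := fun E E' p =>
    p.elim (E₁ ∪ E₂)ᶜ fun b => bif b then E else E'
  have hpart : ∀ E E' : Set T, (E = E₁ ∧ E' = E₂ ∨ E = E₂ ∧ E' = E₁) → ∀ A X : Set T,
      IsPiecewise (part E E') (fun p q => p = none ∧ q ≠ none)
        ((Fin.cons A (Fin.cons X W) : Fin (m + 2) → Set T) s.succ.succ) ∧
      ⋃ p, part E E' p = Set.univ := by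
    intro E E' hEE A X
    have hdisj : ∀ x, x ∈ E → x ∉ E' := by
      rcases hEE with ⟨rfl, rfl⟩ | ⟨rfl, rfl⟩
      · exact fun x h => hE' h
      · exact fun x h => hE'' h
    have hE : ∀ y ∈ E, ∀ z ∉ E, (z ≤ y ↔ z ∈ W s) ∧ ¬ y ≤ z := by
      rcases hEE with ⟨rfl, rfl⟩ | ⟨rfl, rfl⟩
      · exact hE₁
      · exact hE₂
    have hE2 : ∀ y ∈ E', ∀ z ∉ E', (z ≤ y ↔ z ∈ W s) ∧ ¬ y ≤ z := by
      rcases hEE with ⟨rfl, rfl⟩ | ⟨rfl, rfl⟩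
      · exact hE₂
      · exact hE₁
    have hrest : ∀ x, x ∈ (E₁ ∪ E₂)ᶜ ↔ x ∉ E ∧ x ∉ E' := by
      intro x
      rcases hEE with ⟨rfl, rfl⟩ | ⟨rfl, rfl⟩ <;> simp [and_comm]
    have h0 : ∀ x, x ∈ part E E' none ↔ x ∉ E ∧ x ∉ E' := hrest
    have h1 : part E E' (some true) = E := rfl
    have h2 : part E E' (some false) = E' := rfl
    refine ⟨⟨?_, ?_⟩, ?_⟩
    · rintro (_ | _ | _) (_ | _ | _) x hx hx' <;>
        simp only [h0, h1, h2] at hx hx' <;> first | rfl | (exfalso; have := hdisj x; tauto)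
    · rintro (_ | _ | _) (_ | _ | _) hpq x hx y hy <;>
        simp only [h0, h1, h2] at hx hy <;>
        simp only [Fin.cons_succ, ne_eq, reduceCtorEq, not_false_eq_true, not_true_eq_false,
          true_and, false_and, and_self, and_true, iff_false] at hpq ⊢
      · exact (hE2 y hy x hx.2).1
      · exact (hE y hy x hx.1).1
      · exact (hE2 x hx y hy.2).2
      · exact (hE2 x hx y (hdisj y hy)).2
      · exact (hE x hx y hy.1).2
      · exact (hE x hx y fun h => hdisj y h hy).2
    · refine Set.eq_univ_of_forall fun x => Set.mem_iUnion.2 ?_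
      by_cases hx : x ∈ E
      · exact ⟨some true, hx⟩
      by_cases hx' : x ∈ E'
      · exact ⟨some false, hx'⟩
      exact ⟨none, (hrest x).2 ⟨hx, hx'⟩⟩
  have hne : ∀ t, t ∈ E₂ → t ≠ x₁ := fun t ht e => hE'' ht (e ▸ h₁)
  have hne' : ∀ t, t ∈ E₁ → t ≠ x₂ := fun t ht e => hE' ht (e ▸ h₂)
  obtain ⟨hp, hu⟩ := hpart E₁ E₂ (Or.inl ⟨rfl, rfl⟩) {x₁} {x₁, x₂}
  obtain ⟨hp', hu'⟩ := hpart E₂ E₁ (Or.inr ⟨rfl, rfl⟩) {x₂} {x₁, x₂}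
  have := mtype_iUnion (k := k) hp hp' ?_
  · rwa [hu, hu'] at this
  rintro (_ | _ | _)
  · refine mtype_congr_cons (fun t ht => ?_) (fun t ht => Iff.rfl)
    have ht : t ∉ E₁ ∧ t ∉ E₂ := not_or.1 ht
    have ht1 : t ≠ x₁ := fun e => ht.1 (e ▸ h₁)
    have ht2 : t ≠ x₂ := fun e => ht.2 (e ▸ h₂)
    simp [ht1, ht2]
  · change mtype k E₂ _ = mtype k E₁ _
    rw [mtype_congr_cons (A' := ∅) (X' := {x₂}) (D := E₂) (fun t ht => by simp [hne t ht])
      (fun t ht => by simp [hne t ht]),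
      mtype_congr_cons (A' := ∅) (X' := {x₁}) (D := E₁) (fun t ht => by simp [hne' t ht])
      (fun t ht => by simp [hne' t ht])]
    exact (mtype_remark h 1 0).symm
  · change mtype k E₁ _ = mtype k E₂ _
    rw [mtype_congr_cons (A' := {x₂}) (X' := {x₂}) (D := E₂) (fun t ht => by simp)
      (fun t ht => by simp [hne t ht]),
      mtype_congr_cons (A' := {x₁}) (X' := {x₁}) (D := E₁) (fun t ht => by simp)
      (fun t ht => by simp [hne' t ht])]
    exact mtype_remark h 0 0

/-! ### The cones above an initial segment -/

section TopClass

/-- The `∼¹`-class of `x` among the elements above the initial segment `A`. -/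
def topClass (A : Set T) (x : T) : Set T := {y | y ∈ top A \ A ∧ Sim1 A x y}

variable {A : Set T} {x y z : T}

theorem sim0_of_mem_top (hx : x ∈ top A \ A) (hy : y ∈ top A \ A) : Sim0 A x y :=
  ⟨hx.2, hy.2, fun t ht => ⟨fun _ => hy.1 t ht, fun _ => hx.1 t ht⟩⟩

theorem mem_topClass_iff (hx : x ∈ top A \ A) :
    y ∈ topClass A x ↔ ∃ z ∈ top A \ A, z ≤ x ∧ z ≤ y := by
  constructor
  · rintro ⟨-, -, z, hzx, hzy, hz, -, h⟩
    exact ⟨z, ⟨fun t ht => (h t ht).2 (hx.1 t ht), hz⟩, hzx, hzy⟩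
  · rintro ⟨z, hz, hzx, hzy⟩
    have hy : y ∈ top A \ A :=
      ⟨fun t ht => (hz.1 t ht).trans hzy, fun hyA => ?_⟩
    · exact ⟨hy, sim0_of_mem_top hx hy, z, hzx, hzy, sim0_of_mem_top hz hx⟩
    · exact hz.2 (le_antisymm hzy (hz.1 y hyA) ▸ hyA)

theorem self_mem_topClass (hx : x ∈ top A \ A) : x ∈ topClass A x :=
  (mem_topClass_iff hx).2 ⟨x, hx, le_rfl, le_rfl⟩

/-- In a tree two elements with a common upper bound are comparable, so the witnesses `a`, `b`, `d`
have a common lower bound among themselves. -/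
theorem topClass_subset (hT : IsTree T) (hx : x ∈ top A \ A) (hy : y ∈ top A \ A)
    (hz : z ∈ topClass A x) (hz' : z ∈ topClass A y) : topClass A x ⊆ topClass A y := by
  intro u hu
  obtain ⟨a, ha, hax, haz⟩ := (mem_topClass_iff hx).1 hz
  obtain ⟨b, hb, hby, hbz⟩ := (mem_topClass_iff hy).1 hz'
  obtain ⟨d, hd, hdx, hdu⟩ := (mem_topClass_iff hx).1 hu
  rw [mem_topClass_iff hy]
  have min_le : ∀ {p q r : T}, p ∈ top A \ A → q ∈ top A \ A → p ≤ r → q ≤ r →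
      ∃ s ∈ top A \ A, s ≤ p ∧ s ≤ q := fun {p q r} hp hq hpr hqr =>
    ((hT r).total hpr hqr).elim (fun h => ⟨p, hp, le_rfl, h⟩) fun h => ⟨q, hq, h, le_rfl⟩
  obtain ⟨e, he, hea, heb⟩ := min_le ha hb haz hbz
  obtain ⟨f, hf, hfe, hfd⟩ := min_le he hd (hea.trans hax) hdx
  exact ⟨f, hf, hfe.trans (heb.trans hby), hfd.trans hdu⟩

/-- This is the hypothesis of `mtype_swap`: a class is upward closed and, from outside, has exactly
the elements of `A` below it. -/
theorem topClass_isCone (hT : IsTree T) (hA : IsLowerSet A) (hx : x ∈ top A \ A)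
    (hy : y ∈ topClass A x) (hz : z ∉ topClass A x) : (z ≤ y ↔ z ∈ A) ∧ ¬ y ≤ z := by
  obtain ⟨a, ha, hax, hay⟩ := (mem_topClass_iff hx).1 hy
  refine ⟨⟨fun hzy => ?_, fun hzA => hy.1.1 z hzA⟩, fun hyz => ?_⟩
  · by_contra hzA
    have hz' : z ∈ top A \ A := by
      refine ⟨fun t ht => ?_, hzA⟩
      exact ((hT y).total (hy.1.1 t ht) hzy).resolve_right fun h => hzA (hA h ht)
    refine hz ((mem_topClass_iff hx).2 ?_)
    rcases (hT y).total hay hzy with h | h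
    · exact ⟨a, ha, hax, h⟩
    · exact ⟨z, hz', h.trans hax, le_rfl⟩
  · exact hz ((mem_topClass_iff hx).2 ⟨a, ha, hax, hay.trans hyz⟩)

end TopClass

/-- Unbounded splitting yields more `∼¹`-classes than any given natural number. -/
theorem UnboundedSplitting.exists_lt (h : UnboundedSplitting T) (N : ℕ) :
    ∃ A : Set T, IsInitialSegment A ∧ (N : Cardinal.{u}) < Cardinal.mk (topClasses A) := by
  by_contra! hcon
  have : (⨆ A : {A : Set T // IsInitialSegment A}, Cardinal.mk (topClasses A.1)) ≤
      (N : Cardinal.{u}) := ciSup_le' fun A => hcon A.1 A.2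
  exact (h.trans this).not_gt (Cardinal.natCast_lt_aleph0)

theorem exists_antichain_not_choosesFrom (hT : IsTree T) (h : UnboundedSplitting T)
    (φ : Formula 1 (l + 1)) (P : Fin l → Set T) :
    ∃ A : Set T, A.Nonempty ∧ IsAntichain (· ≤ ·) A ∧ ¬ ChoosesFrom φ P A := by
  obtain ⟨A, hA, hcard⟩ := h.exists_lt (Nat.card (MType φ.depth (l + 3)))
  choose x hx hxC using fun C : topClasses A => C.2
  have hxC' : ∀ C, topClass A (x C) = C.1 := hxC
  -- There are more classes than colours, so two classes with marked representatives have equal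
  -- types.
  let color : topClasses A → MType φ.depth (l + 3) := fun C =>
    mtype φ.depth (topClass A (x C)) (Fin.cons {x C} (Fin.cons ∅ (Fin.cons A P)))
  have hinj : ¬ Function.Injective color := by
    intro hinj
    have := Finite.of_injective color hinj
    have hle := Nat.card_le_card_of_injective color hinj
    rw [← Nat.cast_card (α := topClasses A)] at hcard
    exact (Nat.cast_lt.1 hcard).not_ge hle
  simp only [Function.Injective, not_forall] at hinj
  obtain ⟨C, C', hCC', hne⟩ := hinj
  have hdisj : Disjoint (topClass A (x C)) (topClass A (x C')) := by
    rw [Set.disjoint_left]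
    intro z hz hz'
    refine hne (Subtype.ext ?_)
    rw [← hxC', ← hxC']
    exact (topClass_subset hT (hx C) (hx C') hz hz').antisymm
      (topClass_subset hT (hx C') (hx C) hz' hz)
  have hmem := self_mem_topClass (hx C)
  have hmem' := self_mem_topClass (hx C')
  have hnot := Set.disjoint_left.1 hdisj hmem
  have hnot' := Set.disjoint_right.1 hdisj hmem'
  have hcone := fun y hy z hz => topClass_isCone (y := y) (z := z) hT hA.2 (hx C) hy hz
  have hcone' := fun y hy z hz => topClass_isCone (y := y) (z := z) hT hA.2 (hx C') hy hz
  have htype := mtype_swap (W := (Fin.cons A P : Fin (l + 1) → Set T)) (s := 0) hdisj hmem hmem'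
    hcone hcone' hCC'
  refine ⟨{x C, x C'}, ⟨x C, by simp⟩, ?_, ?_⟩
  · intro a ha b hb hab
    simp only [Set.mem_insert_iff, Set.mem_singleton_iff] at ha hb
    rcases ha with rfl | rfl <;> rcases hb with rfl | rfl
    · exact (hab rfl).elim
    · exact (hcone _ hmem _ hnot').2
    · exact (hcone' _ hmem' _ hnot).2
    · exact (hab rfl).elim
  · rintro ⟨a, ha, huniq⟩
    have hxne : x C ≠ x C' := fun e => hnot (e ▸ hmem')
    have h1 := (huniq a).2 rfl
    rcases ha with rfl | ha
    · exact hxne.symm ((huniq _).1 (holds_of_mtype_eq le_rfl htype h1))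
    · obtain rfl : a = x C' := ha
      exact hxne ((huniq _).1 (holds_of_mtype_eq le_rfl htype.symm h1))

/-! ### Segments of a chain -/

/-- The part of the tree above `x` and not above `y`. -/
def segment (x y : T) : Set T := {t | x ≤ t ∧ ¬ y ≤ t}

/-- Parts of a tree separated by elements of a downward closed chain `J`. -/
theorem isPiecewise_of_separated (hT : IsTree T) {J : Set T} (hJ : IsChain (· ≤ ·) J)
    (hJ' : IsLowerSet J) {I : Type*} [LinearOrder I] {D : I → Set T}
    (h : ∀ p q, p < q → ∃ x ∈ J, (∀ t ∈ D p, ¬ x ≤ t) ∧ ∀ t ∈ D q, x ≤ t) :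
    IsPiecewise D (· < ·) J := by
  constructor
  · intro p q x hp hq
    by_contra hpq
    rcases lt_or_gt_of_ne hpq with hlt | hlt
    · obtain ⟨y, -, h1, h2⟩ := h p q hlt
      exact h1 x hp (h2 x hq)
    · obtain ⟨y, -, h1, h2⟩ := h q p hlt
      exact h1 x hq (h2 x hp)
  · intro p q hpq t ht u hu
    rcases lt_or_gt_of_ne hpq with hlt | hlt
    · obtain ⟨x, hx, h1, h2⟩ := h p q hlt
      refine ⟨fun htu => ⟨hlt, ?_⟩, fun htJ => ?_⟩
      -- Both `t` and the separator `x` lie below `u`, so they are comparable; as `x ≤ t` fails, `t`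
      -- lies below `x` and hence in `J`.
      · exact hJ' (((hT u).total htu (h2 u hu)).resolve_right (h1 t ht)) hx
      · exact ((hJ.total htJ.2 hx).resolve_right (h1 t ht)).trans (h2 u hu)
    · obtain ⟨x, hx, h1, h2⟩ := h q p hlt
      exact ⟨fun htu => (h1 u hu ((h2 t ht).trans htu)).elim, fun h => (hlt.not_gt h.1).elim⟩

section Chain

variable {α : Type u} [LinearOrder α] {e : α ↪o T}

theorem isChain_range : IsChain (· ≤ ·) (Set.range e) := by
  rintro _ ⟨a, rfl⟩ _ ⟨b, rfl⟩ -
  exact (le_total a b).imp (e.le_iff_le.2 ·) (e.le_iff_le.2 ·)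

/-- The colouring of pairs of a chain by the types of the segments. -/
def segmentColouring (e : α ↪o T) (k : ℕ) (P : Fin l → Set T) (a b : α) : MType k (l + 3) :=
  mtype k (segment (e a) (e b)) (Fin.cons {e a} (Fin.cons ∅ (Fin.cons (Set.range e) P)))

/-- The segment from `a` to `d` is the union of those from `a` to `b` and from `b` to `d`, separated
by `e b`. The mark at `e a` is invisible in the second. -/
theorem coherent_segmentColouring (hT : IsTree T) (he : IsLowerSet (Set.range e)) (k : ℕ)
    (P : Fin l → Set T) : Coherent (segmentColouring e k P) := by
  let D : α → α → α → Bool → Set T := fun a b d p =>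
    bif p then segment (e b) (e d) else segment (e a) (e b)
  have hD : ∀ a b d, a < b → b < d → IsPiecewise (D a b d) (· < ·) (Set.range e) := by
    intro a b d hab hbd
    refine isPiecewise_of_separated hT isChain_range he fun p q hpq => ?_
    obtain ⟨rfl, rfl⟩ := Bool.lt_iff.1 hpq
    exact ⟨e b, ⟨b, rfl⟩, fun t ht => ht.2, fun t ht => ht.1⟩
  have hU : ∀ a b d, a < b → b < d → ⋃ p, D a b d p = segment (e a) (e d) := by
    intro a b d hab hbd
    ext t
    simp only [Set.mem_iUnion, Bool.exists_bool, D, cond_false, cond_true]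
    constructor
    · rintro (ht | ht)
      · exact ⟨ht.1, fun h => ht.2 ((e.le_iff_le.2 hbd.le).trans h)⟩
      · exact ⟨(e.le_iff_le.2 hab.le).trans ht.1, ht.2⟩
    · intro ht
      by_cases hb : e b ≤ t
      · exact Or.inr ⟨hb, ht.2⟩
      · exact Or.inl ⟨ht.1, hb⟩
  have hempty : ∀ a b d, a < b → ∀ t ∈ segment (e b) (e d),
      t ∈ ({e a} : Set T) ↔ t ∈ (∅ : Set T) := by
    intro a b d hab t ht
    simp only [Set.mem_singleton_iff, Set.mem_empty_iff_false, iff_false]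
    rintro rfl
    exact hab.not_ge (e.le_iff_le.1 ht.1)
  intro x y z x' y' z' hxy hyz hxy' hyz' h1 h2
  unfold segmentColouring
  rw [← hU x y z hxy hyz, ← hU x' y' z' hxy' hyz']
  refine mtype_iUnion (s := Fin.succ (Fin.succ 0)) (hD x y z hxy hyz) (hD x' y' z' hxy' hyz') ?_
  rintro (_ | _)
  · exact h1
  · change mtype k (segment (e y) (e z)) _ = mtype k (segment (e y') (e z')) _
    rw [mtype_congr_cons (A' := ∅) (hempty x y z hxy) (fun _ _ => Iff.rfl),
      mtype_congr_cons (A' := ∅) (hempty x' y' z' hxy') (fun _ _ => Iff.rfl)]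
    exact mtype_remark h2 1 1

/-! ### Cutting the tree along a copy of the integers -/

/-- The elements lying above exactly those `x i` with `i ≤ p`. -/
def intPart (x : ℤ → T) (p : WithBot (WithTop ℤ)) : Set T :=
  {t | ∀ i : ℤ, x i ≤ t ↔ ((i : WithTop ℤ) : WithBot (WithTop ℤ)) ≤ p}

theorem intPart_coe {x : ℤ → T} (hx : StrictMono x) (i : ℤ) :
    intPart x ((i : WithTop ℤ) : WithBot (WithTop ℤ)) = segment (x i) (x (i + 1)) := by
  ext t
  simp only [intPart, Set.mem_ofPred_eq, WithBot.coe_le_coe, WithTop.coe_le_coe, segment]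
  constructor
  · intro h
    exact ⟨(h i).2 le_rfl, fun h' => by have := (h (i + 1)).1 h'; omega⟩
  · rintro ⟨h1, h2⟩ j
    constructor
    · intro hj
      by_contra! hlt
      exact h2 ((hx.monotone (Int.add_one_le_iff.2 hlt)).trans hj)
    · exact fun hj => (hx.monotone hj).trans h1

theorem iUnion_intPart {x : ℤ → T} (hx : StrictMono x) : ⋃ p, intPart x p = Set.univ := by
  refine Set.eq_univ_of_forall fun t => Set.mem_iUnion.2 ?_
  by_cases h1 : ∃ i, x i ≤ t
  swap
  · push Not at h1
    exact ⟨⊥, fun i => iff_of_false (h1 i) (by simp)⟩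
  by_cases h2 : ∃ j, ¬ x j ≤ t
  swap
  · push Not at h2
    exact ⟨((⊤ : WithTop ℤ) : WithBot (WithTop ℤ)),
      fun i => iff_of_true (h2 i) (WithBot.coe_le_coe.2 le_top)⟩
  obtain ⟨j, hj⟩ := h2
  obtain ⟨i, hi, hmax⟩ := Int.exists_greatest_of_bdd (P := fun i => x i ≤ t)
    ⟨j, fun i hi => by
      by_contra! hlt
      exact hj ((hx.monotone hlt.le).trans hi)⟩ h1
  refine ⟨((i : WithTop ℤ) : WithBot (WithTop ℤ)), ?_⟩
  rw [intPart_coe hx]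
  exact ⟨hi, fun h => by have := hmax _ h; omega⟩

theorem isPiecewise_intPart (hT : IsTree T) {J : Set T} (hJ : IsChain (· ≤ ·) J)
    (hJ' : IsLowerSet J) {x : ℤ → T} (hxJ : ∀ i, x i ∈ J) :
    IsPiecewise (intPart x) (· < ·) J := by
  refine isPiecewise_of_separated hT hJ hJ' fun p q hpq => ?_
  obtain ⟨i, hpi, hiq⟩ : ∃ i : ℤ, ¬ ((i : WithTop ℤ) : WithBot (WithTop ℤ)) ≤ p ∧
      ((i : WithTop ℤ) : WithBot (WithTop ℤ)) ≤ q := by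
    induction q using WithBot.recBotCoe with
    | bot => exact (not_lt_bot hpq).elim
    | coe q =>
      induction p using WithBot.recBotCoe with
      | bot =>
        induction q using WithTop.recTopCoe with
        | top => exact ⟨0, by simp, WithBot.coe_le_coe.2 le_top⟩
        | coe q => exact ⟨q, by simp, le_rfl⟩
      | coe p =>
        induction p using WithTop.recTopCoe with
        | top => exact (not_top_lt (WithBot.coe_lt_coe.1 hpq)).elim
        | coe p =>
          refine ⟨p + 1, ?_, ?_⟩
          · rw [WithBot.coe_le_coe, WithTop.coe_le_coe]; omega
          · induction q using WithTop.recTopCoe with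
            | top => exact WithBot.coe_le_coe.2 le_top
            | coe q =>
              rw [WithBot.coe_lt_coe, WithTop.coe_lt_coe] at hpq
              rw [WithBot.coe_le_coe, WithTop.coe_le_coe]
              omega
  exact ⟨x i, hxJ i, fun t ht h => hpi ((ht i).1 h), fun t ht => (ht i).2 hiq⟩

/-- Along a homogeneous copy of the integers, neighbours have the same type. -/
theorem mtype_shift (hT : IsTree T) (he : IsLowerSet (Set.range e)) {k : ℕ} {P : Fin l → Set T}
    {w : ℤ → α} (hw : StrictMono w) {f : MType k (l + 3)}
    (hf : ∀ i, segmentColouring e k P (w i) (w (i + 1)) = f) (i : ℤ) :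
    mtype k Set.univ (Fin.cons {e (w i)} (Fin.cons (Set.range (e ∘ w))
      (Fin.cons (Set.range e) P)) : Fin (l + 3) → Set T) =
    mtype k Set.univ (Fin.cons {e (w (i + 1))} (Fin.cons (Set.range (e ∘ w))
      (Fin.cons (Set.range e) P))) := by
  let x : ℤ → T := e ∘ w
  have hx : StrictMono x := e.strictMono.comp hw
  let x' : ℤ → T := fun i => x (i + 1)
  have hx' : StrictMono x' := fun i j hij => hx (by omega)
  have hxJ : ∀ i, x i ∈ Set.range e := fun i => ⟨_, rfl⟩
  have main := mtype_iUnion (k := k) (s := Fin.succ (Fin.succ 0))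
    (V := (Fin.cons {x i} (Fin.cons (Set.range x) (Fin.cons (Set.range e) P)) :
      Fin (l + 3) → Set T))
    (V' := (Fin.cons {x (i + 1)} (Fin.cons (Set.range x) (Fin.cons (Set.range e) P)) :
      Fin (l + 3) → Set T))
    (isPiecewise_intPart hT isChain_range he hxJ)
    (isPiecewise_intPart (x := x') hT isChain_range he fun i => hxJ _) ?_
  · rwa [iUnion_intPart hx, iUnion_intPart hx'] at main
  have hseg : ∀ i j, x i ∈ segment (x j) (x (j + 1)) ↔ i = j := by
    intro i j
    simp only [segment, Set.mem_ofPred_eq, hx.le_iff_le]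
    omega
  -- The two end parts, above none or above all of the `x i`, are unaffected by the shift and
  -- contain no `x i`.
  have hfix : ∀ p, (∀ i : ℤ, p ≠ ((i : WithTop ℤ) : WithBot (WithTop ℤ))) →
      intPart x' p = intPart x p ∧ ∀ t ∈ intPart x p, ∀ i, t ≠ x i := by
    intro p hp
    have hp' : p = ⊥ ∨ p = ((⊤ : WithTop ℤ) : WithBot (WithTop ℤ)) := by
      induction p using WithBot.recBotCoe with
      | bot => exact Or.inl rfl
      | coe p =>
        induction p using WithTop.recTopCoe with
        | top => exact Or.inr rfl
        | coe p => exact (hp p rfl).elim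
    rcases hp' with rfl | rfl
    · refine ⟨?_, ?_⟩
      · ext t
        simp only [intPart, Set.mem_ofPred_eq, le_bot_iff, WithBot.coe_ne_bot, iff_false]
        exact ⟨fun h i => by simpa [x'] using h (i - 1), fun h i => h (i + 1)⟩
      · rintro t ht i rfl
        simpa using (ht i).1 le_rfl
    · have htop : ∀ i : ℤ, ((i : WithTop ℤ) : WithBot (WithTop ℤ)) ≤
          ((⊤ : WithTop ℤ) : WithBot (WithTop ℤ)) := fun i => WithBot.coe_le_coe.2 le_top
      refine ⟨?_, ?_⟩
      · ext t
        simp only [intPart, Set.mem_ofPred_eq, htop, iff_true]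
        exact ⟨fun h i => by simpa [x'] using h (i - 1), fun h i => h (i + 1)⟩
      · rintro t ht i rfl
        have := hx.le_iff_le.1 ((ht (i + 1)).2 (htop _))
        omega
  intro p
  by_cases hp : ∃ j : ℤ, p = ((j : WithTop ℤ) : WithBot (WithTop ℤ))
  · obtain ⟨j, rfl⟩ := hp
    rw [intPart_coe hx, intPart_coe hx']
    -- The `j`-th segment is compared with the next one. Both carry the mark when `j = i`, and
    -- neither does otherwise.
    have hcol : mtype k (segment (x j) (x (j + 1)))
        (Fin.cons {x j} (Fin.cons ∅ (Fin.cons (Set.range e) P)) : Fin (l + 3) → Set T) =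
        mtype k (segment (x (j + 1)) (x (j + 1 + 1)))
        (Fin.cons {x (j + 1)} (Fin.cons ∅ (Fin.cons (Set.range e) P))) :=
      (hf j).trans (hf (j + 1)).symm
    have hX : ∀ j, ∀ t ∈ segment (x j) (x (j + 1)), t ∈ Set.range x ↔ t ∈ ({x j} : Set T) := by
      rintro j t ht
      constructor
      · rintro ⟨i, rfl⟩
        rw [(hseg i j).1 ht]; rfl
      · rintro rfl; exact ⟨j, rfl⟩
    change mtype k (segment (x j) (x (j + 1))) _ =
      mtype k (segment (x (j + 1)) (x (j + 1 + 1))) _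
    by_cases hij : i = j
    · subst hij
      rw [mtype_congr_cons (fun _ _ => Iff.rfl) (hX i),
        mtype_congr_cons (fun _ _ => Iff.rfl) (hX (i + 1))]
      exact mtype_remark hcol 0 0
    · rw [mtype_congr_cons (A' := ∅) (fun t ht => ?_) (hX j),
        mtype_congr_cons (A' := ∅) (fun t ht => ?_) (hX (j + 1))]
      · exact mtype_remark hcol 1 0
      · simp only [Set.mem_singleton_iff, Set.mem_empty_iff_false, iff_false]
        rintro rfl
        have := (hseg _ _).1 ht
        omega
      · simp only [Set.mem_singleton_iff, Set.mem_empty_iff_false, iff_false]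
        rintro rfl
        exact hij ((hseg _ _).1 ht)
  · push Not at hp
    obtain ⟨h1, h2⟩ := hfix p hp
    rw [h1]
    exact mtype_congr_cons (fun t ht => by simp [h2 t ht]) (fun _ _ => Iff.rfl)

theorem exists_chain_not_choosesFrom_of_hasPattern (hT : IsTree T)
    (he : IsLowerSet (Set.range e)) (φ : Formula 1 (l + 1)) (P : Fin l → Set T) {x y : α}
    (h : HasPattern (Nat.card (MType φ.depth (l + 3)) + 1) α x y) :
    ∃ A : Set T, A.Nonempty ∧ IsChain (· ≤ ·) A ∧ ¬ ChoosesFrom φ P A := by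
  obtain ⟨w, hw, f, hf⟩ :=
    h.hasHomogeneousInt (coherent_segmentColouring hT he φ.depth P) le_rfl
  refine ⟨Set.range (e ∘ w), Set.range_nonempty _, isChain_range.mono
    (Set.range_comp_subset_range w e), ?_⟩
  rintro ⟨_, ⟨i, rfl⟩, huniq⟩
  have h1 := holds_of_mtype_eq le_rfl (mtype_shift hT he hw hf i) ((huniq _).2 rfl)
  have h2 := hw.injective (e.injective ((huniq _).1 h1))
  omega

end Chain

/-! ### Branches -/

/-- In a tree the lower closure of a chain is a chain, and it is convex, so maximality leaves
nothing to add. -/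
theorem IsBranch.isLowerSet (hT : IsTree T) {B : Set T} (hB : IsBranch B) : IsLowerSet B := by
  have hsub : IsSubBranch (lowerClosure B : Set T) := by
    refine ⟨(lowerClosure B).lower.ordConnected, ?_⟩
    rintro s ⟨b, hb, hsb⟩ t ⟨c, hc, htc⟩ -
    rcases hB.prop.2.total hb hc with h | h
    · exact (hT c).total (hsb.trans h) htc
    · exact (hT b).total hsb (htc.trans h)
  rw [hB.eq_of_subset hsub subset_lowerClosure]
  exact (lowerClosure B).lower

/-- A chain as a linear order. -/
noncomputable abbrev chainLinearOrder {B : Set T} (hB : IsChain (· ≤ ·) B) : LinearOrder B :=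
  { (inferInstance : PartialOrder B) with
    le_total := fun a b => hB.total a.2 b.2
    toDecidableLE := Classical.decRel _ }

/-- `HasHdeg` requires the exact degree: either a smaller `β` already is the degree, or the given
decomposition makes `γ` minimal. -/
theorem HasDegreeLE.exists_hasHdeg {α : Type u} [LinearOrder α] (e : α ↪o T) {n : ℕ} {C : Set α}
    (h : HasDegreeLE n C) : ∃ β ≤ (n : Ordinal.{u}), HasHdeg β (e '' C) := by
  have key : ∀ (C : Set α) (γ : Ordinal.{u}), ((γ = 0 ∧ (e '' C).Finite) ∨
      ∃ (I : Type u) (_ : LinearOrder I) (D : I → Set T),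
        (WellFoundedLT I ∨ WellFoundedGT I) ∧ IsConcatenation (e '' C) D ∧
          ∀ i, ∃ β, ∃ _ : β < γ, HasHdeg β (D i)) → ∃ β ≤ γ, HasHdeg β (e '' C) := by
    intro C γ hγ
    by_cases hlt : ∃ β < γ, HasHdeg β (e '' C)
    · obtain ⟨β, hβ, h⟩ := hlt
      exact ⟨β, hβ.le, h⟩
    · push Not at hlt
      refine ⟨γ, le_rfl, ?_⟩
      rw [HasHdeg]
      exact ⟨hlt, hγ⟩
  induction n generalizing C with
  | zero => exact key _ _ (Or.inl ⟨by simp, Set.Finite.image e h⟩)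
  | succ n ih =>
    obtain ⟨I, hI, π, hwf, hπ, hd⟩ := h
    refine key _ _ (Or.inr ⟨I, hI, fun i => e '' (C ∩ π ⁻¹' {i}), hwf, ⟨?_, ?_⟩, fun i => ?_⟩)
    · ext t
      simp only [Set.mem_iUnion]
      constructor
      · rintro ⟨i, a, ha, rfl⟩
        exact ⟨a, ha.1, rfl⟩
      · rintro ⟨a, ha, rfl⟩
        exact ⟨π a, a, ⟨ha, rfl⟩, rfl⟩
    · rintro i j hij _ ⟨a, ⟨ha, rfl⟩, rfl⟩ _ ⟨b, ⟨hb, rfl⟩, rfl⟩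
      exact e.lt_iff_lt.2 (lt_of_not_ge fun hba => hij.not_ge (hπ hb ha hba))
    · obtain ⟨β, hβ, h⟩ := ih (hd i)
      exact ⟨β, hβ.trans_lt (by exact_mod_cast Nat.lt_succ_self n), h⟩

/-- If no branch had a pattern of height `n`, one finite `d` would bound the degrees of all
branches, and their supremum would be below `ω`. -/
theorem exists_branch_hasPattern (h : HasRationalBranch T ∨ HasUnboundedHdeg T) (n : ℕ) :
    ∃ (B : Set T) (hB : IsBranch B) (x y : B),
      @HasPattern n B (chainLinearOrder hB.prop.2) x y := by
  rcases h with ⟨B, hB, ⟨g⟩⟩ | ⟨-, h⟩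
  · let _ := chainLinearOrder hB.prop.2
    exact ⟨B, hB, g 0, g 1, hasPattern_of_strictMono_rat (g := g) g.strictMono one_pos⟩
  · by_contra! hcon
    obtain ⟨d, hd⟩ := exists_hasDegreeLE_univ.{u} n
    refine (h.trans (ciSup_le' fun B => ?_ : _ ≤ (d : Ordinal.{u}))).not_gt
      (Ordinal.natCast_lt_omega0 d)
    let _ := chainLinearOrder B.2.prop.2
    obtain ⟨β, hβ, h⟩ := (hd B.1 (hcon B.1 B.2)).exists_hasHdeg (OrderEmbedding.subtype _)
    refine (csInf_le' ?_).trans hβ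
    simpa using h

theorem exists_chain_not_choosesFrom (hT : IsTree T)
    (h : HasRationalBranch T ∨ HasUnboundedHdeg T) (φ : Formula 1 (l + 1)) (P : Fin l → Set T) :
    ∃ A : Set T, A.Nonempty ∧ IsChain (· ≤ ·) A ∧ ¬ ChoosesFrom φ P A := by
  obtain ⟨B, hB, x, y, hxy⟩ :=
    exists_branch_hasPattern h (Nat.card (MType φ.depth (l + 3)) + 1)
  let _ := chainLinearOrder hB.prop.2
  refine exists_chain_not_choosesFrom_of_hasPattern (e := OrderEmbedding.subtype (· ∈ B)) hT ?_
    φ P hxy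
  simpa using hB.isLowerSet hT

theorem DefinesChoiceFunction.choosesFrom {φ : Formula 1 (l + 1)} {P : Fin l → Set T}
    (h : DefinesChoiceFunction φ P) {A : Set T} (hA : A.Nonempty) : ChoosesFrom φ P A := by
  obtain ⟨y, hy⟩ := h.2.1 A hA
  exact ⟨y, (h.1 y A hy).2, fun b => ⟨fun hb => h.2.2 b y A hb hy, fun hb => hb ▸ hy⟩⟩

end Choice

end WildTree

theorem theorem4p6 {T : Type u} [PartialOrder T] (hT : WildTree.IsTree T)
    (hwild : WildTree.IsWild T) :
    ¬ WildTree.HasDefinableChoiceFunction T ∧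
    (∀ (l : ℕ) (φ : WildTree.Formula 1 (l + 1)) (P : Fin l → Set T),
      ∃ A : Set T, A.Nonempty ∧ (IsChain (· ≤ ·) A ∨ IsAntichain (· ≤ ·) A) ∧
        ¬ WildTree.ChoosesFrom φ P A) ∧
    (WildTree.UnboundedSplitting T →
      ∀ (l : ℕ) (φ : WildTree.Formula 1 (l + 1)) (P : Fin l → Set T),
        ∃ A : Set T, A.Nonempty ∧ IsAntichain (· ≤ ·) A ∧ ¬ WildTree.ChoosesFrom φ P A) ∧
    (WildTree.HasRationalBranch T ∨ WildTree.HasUnboundedHdeg T →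
      ∀ (l : ℕ) (φ : WildTree.Formula 1 (l + 1)) (P : Fin l → Set T),
        ∃ A : Set T, A.Nonempty ∧ IsChain (· ≤ ·) A ∧ ¬ WildTree.ChoosesFrom φ P A) := by
  have hall : ∀ (l : ℕ) (φ : WildTree.Formula 1 (l + 1)) (P : Fin l → Set T),
      ∃ A : Set T, A.Nonempty ∧ (IsChain (· ≤ ·) A ∨ IsAntichain (· ≤ ·) A) ∧
        ¬ WildTree.ChoosesFrom φ P A := by
    intro l φ P
    rcases hwild with h | h
    · obtain ⟨A, hA, hA', h⟩ := WildTree.exists_antichain_not_choosesFrom hT h φ P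
      exact ⟨A, hA, Or.inr hA', h⟩
    · obtain ⟨A, hA, hA', h⟩ := WildTree.exists_chain_not_choosesFrom hT h φ P
      exact ⟨A, hA, Or.inl hA', h⟩
  refine ⟨?_, hall, fun h l φ P => WildTree.exists_antichain_not_choosesFrom hT h φ P,
    fun h l φ P => WildTree.exists_chain_not_choosesFrom hT h φ P⟩
  rintro ⟨l, φ, P, h⟩
  obtain ⟨A, hA, -, hA'⟩ := hall l φ P
  exact hA' (h.choosesFrom hA)
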